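/- For integers $r\ge k\ge 1$, the $(k,r)$-Coloring problem is: given a $k$-colorable finite graph $G$, output a proper coloring of $G$ with $r$ colors. For an integer $k\ge1$ and reals $p\in[0,1]$, $c>0$, $\mu\ge 1$, call a symmetric partial matrix $A\in(\mathbb{Q}\cup\{\bot\})^{n\times n}$ with set of revealed positions $\Omega=\{(i,j):A(i,j)\ne\bot\}$ a *$(k,p,c)$-instance of coherence at most $\mu$* if $|\Omega|\ge pn^2$ and there is a symmetric matrix $M\in\mathbb{R}^{n\times n}$ of rank $k$ such that $|M(i,j)|\le c$ for all $i,j$, $A(i,j)=M(i,j)$ for all $(i,j)\in\Omega$, and $M$ has a (compact) singular value decomposition $M=U\Sigma V^\top$, $U,V\in\mathbb{R}^{n\times k}$, in which every row of $U$ and of $V$ has Euclidean norm at most $\sqrt{k\mu/n}$. The exact $(k,r,p,c)$-Completion problem on matrices of coherence at most $\mu$ is: given such an instance $A$, find $B\in\mathbb{R}^{n\times n}$ of rank at most $r$ with $|B(i,j)|\le c$ for all $i,j$ and $\sum_{(i,j)\in\Omega}|A(i,j)-B(i,j)|^2\le 0$, i.e. $B(i,j)=A(i,j)$ on $\Omega$.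 Polynomial time refers to Turing machines, with graphs given by adjacency matrices and rationals in binary. A real matrix $B$ is output in the usual sense of computable analysis: given $A$ and a precision $t$ in unary, the algorithm prints, in time polynomial in the length of this input, a rational matrix that is entrywise within $2^{-t}$ of $B$, where $B$ depends only on $A$ (printing a rational $B$ exactly is a special case). **Theorem.** Assume that for all constants $r\ge k\ge 3$ the $(k,r)$-Coloring problem is not solvable in polynomial time. Then for all constants $c\ge 1$, $k\ge 3$, $r>k$ and $\mu\ge 1$, no polynomial-time algorithm solves the exact $(k,r,0.9,c)$-Completion problem on matrices of coherence at most $\mu$. Moreover, for every $0<\epsilon<1/2$, the same holds if the output $B$, of rank at most $r$ and with $|B(i,j)|\le c$ for all $i,j$, is only required to satisfy $|A(i,j)-B(i,j)|\le\epsilon$ for all $(i,j)\in\Omega$. -/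

import Mathlib

namespace MatrixCompletion

open Turing Computability

/-! ### Encodings of inputs and outputs as words

Words are over the standard alphabet `Γ'` (two bits and the markers `blank`, `bra`, `ket`,
`comma`). Numbers are written in binary. -/

/-- A word followed by the terminator `s`, for every word of a list. -/
def terminated (s : Γ') (L : List (List Γ')) : List Γ' :=
  L.flatMap fun w => w ++ [s]

/-- A square matrix is written row by row: every entry is followed by `comma`, every row by
`ket`. -/
def matrixRows {α : Type} (e : α → List Γ') {n : ℕ} (A : Matrix (Fin n) (Fin n) α) :
    List (List Γ') :=
  (List.finRange n).map fun i => terminated Γ'.comma ((List.finRange n).map fun j => e (A i j))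

/-- The word that encodes a square matrix whose entries are encoded by `e`. -/
def encodeMatrix {α : Type} (e : α → List Γ') {n : ℕ} (A : Matrix (Fin n) (Fin n) α) : List Γ' :=
  terminated Γ'.ket (matrixRows e A)

/-- A rational in lowest terms: sign bit, binary numerator, the separator `bra`, binary
denominator. -/
def encodeRat (q : ℚ) : List Γ' :=
  Γ'.bit (decide (q < 0)) :: ((encodeNat q.num.natAbs).map Γ'.bit ++
    Γ'.bra :: (encodeNat q.den).map Γ'.bit)

/-- An entry of a partial matrix; `none` stands for the hidden entry `⊥`. -/
def encodeEntry : Option ℚ → List Γ'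
  | none => [Γ'.blank]
  | some q => encodeRat q

open Classical in
/-- A graph is given by its adjacency matrix. -/
noncomputable def encodeGraph {n : ℕ} (G : SimpleGraph (Fin n)) : List Γ' :=
  encodeMatrix (fun p : Prop => [Γ'.bit (decide p)]) (Matrix.of fun i j => G.Adj i j)

/-- A partial matrix together with a precision `t` written in unary. -/
def encodeQuery {n : ℕ} (A : Matrix (Fin n) (Fin n) (Option ℚ)) (t : ℕ) : List Γ' :=
  terminated Γ'.ket (List.replicate t (Γ'.bit true) :: matrixRows encodeEntry A)

/-! The encodings are injective. -/

theorem append_cons_inj {s : Γ'} : ∀ {w w' x x' : List Γ'}, s ∉ w → s ∉ w' →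
    w ++ s :: x = w' ++ s :: x' → w = w' ∧ x = x'
  | [], [], _, _, _, _, h => by simpa using h
  | [], _ :: _, _, _, _, _, h => by simp_all
  | _ :: _, [], _, _, _, _, h => by simp_all
  | a :: w, b :: w', x, x', hw, hw', h => by
    simp only [List.cons_append, List.cons.injEq] at h
    simp only [List.mem_cons, not_or] at hw hw'
    obtain ⟨h1, h2⟩ := append_cons_inj hw.2 hw'.2 h.2
    exact ⟨by rw [h.1, h1], h2⟩

theorem terminated_injective {s : Γ'} : ∀ {L L' : List (List Γ')}, (∀ w ∈ L, s ∉ w) →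
    (∀ w ∈ L', s ∉ w) → terminated s L = terminated s L' → L = L'
  | [], [], _, _, _ => rfl
  | [], _ :: _, _, _, h => by simp [terminated] at h
  | _ :: _, [], _, _, h => by simp [terminated] at h
  | w :: L, w' :: L', hL, hL', h => by
    simp only [terminated, List.flatMap_cons, List.append_assoc, List.singleton_append] at h
    obtain ⟨h1, h2⟩ := append_cons_inj (hL _ (by simp)) (hL' _ (by simp)) h
    rw [h1, terminated_injective (fun v hv => hL v (by simp [hv]))
      (fun v hv => hL' v (by simp [hv])) h2]

theorem ket_notMem_matrixRows {α : Type} {e : α → List Γ'} (hk : ∀ a, Γ'.ket ∉ e a) {n : ℕ}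
    (A : Matrix (Fin n) (Fin n) α) : ∀ w ∈ matrixRows e A, Γ'.ket ∉ w := by
  intro w hw
  simp only [matrixRows, terminated, List.mem_map] at hw
  obtain ⟨i, -, rfl⟩ := hw
  simp [hk]

theorem matrixRows_injective {α : Type} {e : α → List Γ'} (he : Function.Injective e)
    (hc : ∀ a, Γ'.comma ∉ e a) {n m : ℕ} {A : Matrix (Fin n) (Fin n) α}
    {B : Matrix (Fin m) (Fin m) α} (h : matrixRows e A = matrixRows e B) :
    (⟨n, A⟩ : Σ n : ℕ, Matrix (Fin n) (Fin n) α) = ⟨m, B⟩ := by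
  have hn : n = m := by simpa [matrixRows] using congrArg List.length h
  subst hn
  have hA : A = B := by
    ext i j
    have h1 := List.map_inj_left.1 h i (List.mem_finRange i)
    have h2 := terminated_injective (by simp [hc]) (by simp [hc]) h1
    exact he (List.map_inj_left.1 h2 j (List.mem_finRange j))
  rw [hA]

theorem encodeMatrix_injective {α : Type} {e : α → List Γ'} (he : Function.Injective e)
    (hc : ∀ a, Γ'.comma ∉ e a) (hk : ∀ a, Γ'.ket ∉ e a) {n m : ℕ}
    {A : Matrix (Fin n) (Fin n) α} {B : Matrix (Fin m) (Fin m) α}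
    (h : encodeMatrix e A = encodeMatrix e B) :
    (⟨n, A⟩ : Σ n : ℕ, Matrix (Fin n) (Fin n) α) = ⟨m, B⟩ :=
  matrixRows_injective he hc
    (terminated_injective (ket_notMem_matrixRows hk A) (ket_notMem_matrixRows hk B) h)

theorem encodeNat_injective : Function.Injective encodeNat := fun a b h => by
  rw [← decode_encodeNat a, h, decode_encodeNat]

theorem bit_injective : Function.Injective Γ'.bit := fun _ _ h => Γ'.bit.inj h

theorem encodeRat_injective : Function.Injective encodeRat := by
  intro p q h
  simp only [encodeRat, List.cons.injEq, Γ'.bit.injEq, decide_eq_decide] at h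
  obtain ⟨hs, h⟩ := h
  have h' := @terminated_injective Γ'.bra
    [(encodeNat p.num.natAbs).map Γ'.bit, (encodeNat p.den).map Γ'.bit]
    [(encodeNat q.num.natAbs).map Γ'.bit, (encodeNat q.den).map Γ'.bit]
    (by simp) (by simp) (by simpa [terminated] using congrArg (· ++ [Γ'.bra]) h)
  simp only [List.cons.injEq, and_true] at h'
  have h1 := encodeNat_injective (bit_injective.list_map h'.1)
  have h2 := encodeNat_injective (bit_injective.list_map h'.2)
  have h3 : p.num < 0 ↔ q.num < 0 := by simpa using hs
  exact Rat.ext (by omega) h2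

theorem encodeEntry_injective : Function.Injective encodeEntry := by
  intro a b h
  cases a <;> cases b
  · rfl
  · simp [encodeEntry, encodeRat] at h
  · simp [encodeEntry, encodeRat] at h
  · exact congrArg some (encodeRat_injective h)

theorem encodeGraph_injective {n m : ℕ} {G : SimpleGraph (Fin n)} {H : SimpleGraph (Fin m)}
    (h : encodeGraph G = encodeGraph H) :
    (⟨n, G⟩ : Σ n : ℕ, SimpleGraph (Fin n)) = ⟨m, H⟩ := by
  have h' := encodeMatrix_injective (fun a b hab => by simpa using hab) (by simp) (by simp) h
  obtain ⟨rfl, h'⟩ := Sigma.mk.inj h'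
  have hG : G = H := by
    ext i j
    exact iff_of_eq (congrFun (congrFun (eq_of_heq h') i) j)
  rw [hG]

theorem encodeQuery_injective {n m : ℕ} {A : Matrix (Fin n) (Fin n) (Option ℚ)}
    {B : Matrix (Fin m) (Fin m) (Option ℚ)} {t u : ℕ} (h : encodeQuery A t = encodeQuery B u) :
    (⟨n, A⟩ : Σ n : ℕ, Matrix (Fin n) (Fin n) (Option ℚ)) = ⟨m, B⟩ ∧ t = u := by
  have hk : ∀ a, Γ'.ket ∉ encodeEntry a := by rintro (_ | a) <;> simp [encodeEntry, encodeRat]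
  have hc : ∀ a, Γ'.comma ∉ encodeEntry a := by rintro (_ | a) <;> simp [encodeEntry, encodeRat]
  have h' := terminated_injective (by simpa using ket_notMem_matrixRows hk A)
    (by simpa using ket_notMem_matrixRows hk B) h
  rw [List.cons.injEq] at h'
  exact ⟨matrixRows_injective encodeEntry_injective hc h'.2,
    by simpa using congrArg List.length h'.1⟩

/-! ### The coloring problem -/

/-- The type of all `k`-colorable finite graphs with vertex set `Fin n`, for every `n`. -/
abbrev ColorableGraph (k : ℕ) : Type :=
  {G : Σ n : ℕ, SimpleGraph (Fin n) // G.2.Colorable k}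

/-- The `(k, r)`-coloring problem is solvable in polynomial time: a Turing machine maps (the
adjacency matrix of) every `k`-colorable graph, in time polynomial in the length of the input, to
the list of the colors of the vertices in some proper coloring with `r` colors. -/
def ColoringInP (k r : ℕ) : Prop :=
  ∃ f : ∀ G : ColorableGraph k, G.1.2.Coloring (Fin r),
    Nonempty (TM2ComputableInPolyTime (fun G : ColorableGraph k => encodeGraph G.1.2) id
      (fun G => List.ofFn fun v => f G v))

/-- For all constants `r ≥ k ≥ 3`, the `(k, r)`-coloring problem is not in P. -/
def ColoringConjecture : Prop :=
  ∀ k r : ℕ, 3 ≤ k → k ≤ r → ¬ ColoringInP k r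

/-! ### The completion problem -/

/-- `M` has rank `k` and coherence (at most) `μ`: some (compact) singular value decomposition
`M = U Σ Vᵀ` has all rows of `U` and `V` of Euclidean norm at most `√(kμ/n)`. -/
def HasRankCoherence (k : ℕ) (μ : ℝ) {n : ℕ} (M : Matrix (Fin n) (Fin n) ℝ) : Prop :=
  M.rank = k ∧
  ∃ (U V : Matrix (Fin n) (Fin k) ℝ) (σ : Fin k → ℝ),
    U.transpose * U = 1 ∧ V.transpose * V = 1 ∧ (∀ l, 0 < σ l) ∧
    M = U * Matrix.diagonal σ * V.transpose ∧
    (∀ i, ‖WithLp.toLp 2 (U i)‖ ≤ √(k * μ / n)) ∧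
    (∀ i, ‖WithLp.toLp 2 (V i)‖ ≤ √(k * μ / n))

/-- The set `Ω` of revealed positions of a partial matrix. -/
def revealed {n : ℕ} (A : Matrix (Fin n) (Fin n) (Option ℚ)) : Finset (Fin n × Fin n) :=
  Finset.univ.filter fun q => (A q.1 q.2).isSome

/-- The admissible inputs: a symmetric partial matrix with at least `p n²` revealed entries, all
of which agree with one symmetric real matrix `M` of rank `k` and coherence at most `μ`, whose
entries are at most `c` in absolute value. -/
def IsInstance (k : ℕ) (p c μ : ℝ) {n : ℕ} (A : Matrix (Fin n) (Fin n) (Option ℚ)) : Prop :=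
  A.IsSymm ∧ p * (n : ℝ) ^ 2 ≤ (revealed A).card ∧
  ∃ M : Matrix (Fin n) (Fin n) ℝ, M.IsSymm ∧ HasRankCoherence k μ M ∧
    (∀ i j, |M i j| ≤ c) ∧ ∀ i j a, A i j = some a → (a : ℝ) = M i j

/-- The type of all admissible inputs, of every size `n`. -/
abbrev Instance (k : ℕ) (p c μ : ℝ) : Type :=
  {A : Σ n : ℕ, Matrix (Fin n) (Fin n) (Option ℚ) // IsInstance k p c μ A.2}

/-- The admissible outputs of the completion problem with error `ε` (in mean square):
rank at most `r`, entries bounded by `c`, and `∑_{(i,j) ∈ Ω} |A i j - B i j|² ≤ ε n`. -/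
def IsCompletion (r : ℕ) (ε c : ℝ) {n : ℕ} (A : Matrix (Fin n) (Fin n) (Option ℚ))
    (B : Matrix (Fin n) (Fin n) ℝ) : Prop :=
  B.rank ≤ r ∧ (∀ i j, |B i j| ≤ c) ∧
  ∑ i, ∑ j, (A i j).elim 0 (fun a => |(a : ℝ) - B i j| ^ 2) ≤ ε * n

/-- The admissible outputs when only an additive error `ε` in every revealed entry is asked for. -/
def IsEntrywiseCompletion (r : ℕ) (ε c : ℝ) {n : ℕ} (A : Matrix (Fin n) (Fin n) (Option ℚ))
    (B : Matrix (Fin n) (Fin n) ℝ) : Prop :=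
  B.rank ≤ r ∧ (∀ i j, |B i j| ≤ c) ∧ ∀ i j a, A i j = some a → |(a : ℝ) - B i j| ≤ ε

/-- A polynomial-time Turing machine finds, for every admissible input `A`, a real matrix `B` with
`Out A B`. As `B` may be irrational, it is produced as real numbers are in computable analysis:
given `A` and a precision `t` in unary, the machine prints a rational matrix that is entrywise
within `2⁻ᵗ` of `B`, where `B` depends on `A` alone. (Printing a rational `B` exactly, whatever `t`
is, is a special case.) -/
def CompletionInP (k : ℕ) (p c μ : ℝ)
    (Out : ∀ {n : ℕ}, Matrix (Fin n) (Fin n) (Option ℚ) → Matrix (Fin n) (Fin n) ℝ → Prop) :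
    Prop :=
  ∃ f : ∀ A : Instance k p c μ, ℕ → Matrix (Fin A.1.1) (Fin A.1.1) ℚ,
    Nonempty (TM2ComputableInPolyTime (fun x : Instance k p c μ × ℕ => encodeQuery x.1.1.2 x.2) id
      (fun x => encodeMatrix encodeRat (f x.1 x.2))) ∧
    ∀ A, ∃ B : Matrix (Fin A.1.1) (Fin A.1.1) ℝ, Out A.1.2 B ∧
      ∀ t i j, |(f A t i j : ℝ) - B i j| ≤ 1 / 2 ^ t

/-- The `(k, r, p, ε, c)`-completion problem is solvable in polynomial time on matrices of
coherence at most `μ`. -/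
def CompletionProblemInP (k r : ℕ) (p ε c μ : ℝ) : Prop :=
  CompletionInP k p c μ (IsCompletion r ε c)

/-- The same with additive error `ε` in every revealed entry instead of the mean square error. -/
def EntrywiseCompletionProblemInP (k r : ℕ) (p ε c μ : ℝ) : Prop :=
  CompletionInP k p c μ (IsEntrywiseCompletion r ε c)

end MatrixCompletion

namespace MatrixCompletion

open Turing Computability StateTransition

/-! ### Counting steps -/

/-! A `k`-colorable graph is turned into a partial 0/1 matrix that a proper coloring completes to
the same-class matrix: 1 on the diagonal, 0 at edges, pairs with unknown relation hidden.
Conversely, suppose a matrix `B` of rank at most `r` with entries bounded by `c` is within `ε < 1/2`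
of the revealed entries. For adjacent `v` and `w` the entries at `(v, v)` and `(w, v)` are near 1
and near 0, so the two rows differ by at least `1 - 2 * ε` in column `v`. All rows lie in a space of
dimension at most `r` and in its sup-norm ball of radius `c`; comparing volumes
(`card_le_of_separated_rows`) bounds the number of pairwise separated rows by a constant that does
not depend on the size. A greedy net therefore sorts the rows into a constant number `K` of colors
such that rows of equal color are close, and this is a proper `K`-coloring of the graph
(`exists_coloringInP`), against the conjecture for `(k, K)`. The exact problem is the case `ε = 0`.

Low coherence and density come from padding. Each vertex has `k` copies, and copy `a` gets class `χ
v + a`; every class then contains one copy of every vertex, so the classes are balanced whatever the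
coloring is, and coherence is minimal (`hasRankCoherence_classMatrix`). Twenty further groups of `k`
indices per vertex have known classes and are revealed against each other, a share of `(20/21)^2 >
0.9` of all positions (`isInstance_blockMatrix`).

It remains to run this in polynomial time. Four-stack machines with linear running time
(`polyTime_of_machine`) are chained by `polyTime_comp`: `polyTime_mark` and `polyTime_expand` write
the query, the assumed algorithm is called at one fixed precision, `polyTime_round` replaces entries
by boundedly many levels, `polyTime_net` builds the net. The positive gap `1 - 2 * ε` absorbs
approximation and rounding errors. As levels and centers are bounded in number, the entries of all
centers in one column fit into a single stack symbol. -/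

/-- `f` leads from `a` to `b` in exactly `n` steps. -/
inductive StepsIn {α : Type*} (f : α → Option α) : ℕ → α → α → Prop
  | refl (a : α) : StepsIn f 0 a a
  | head {n : ℕ} {a b c : α} : f a = some b → StepsIn f n b c → StepsIn f (n + 1) a c

theorem StepsIn.trans {α : Type*} {f : α → Option α} {n m : ℕ} {a b c : α}
    (h : StepsIn f n a b) (h' : StepsIn f m b c) : StepsIn f (n + m) a c := by
  induction h with
  | refl => simpa using h'
  | head h1 _ ih => rw [Nat.add_right_comm]; exact .head h1 (ih h')

theorem stepsIn_iff_iterate {α : Type*} {f : α → Option α} {n : ℕ} {a b : α} :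
    StepsIn f n a b ↔ (flip bind f)^[n] (some a) = some b := by
  constructor
  · intro h
    induction h with
    | refl => rfl
    | head h1 _ ih =>
      rw [Function.iterate_succ_apply]
      simpa [flip, h1] using ih
  · induction n generalizing a with
    | zero => intro h; simp at h; subst h; exact .refl _
    | succ n ih =>
      intro h
      rw [Function.iterate_succ_apply] at h
      cases hfa : f a with
      | none =>
        exfalso
        have : ∀ m, (flip bind f)^[m] (none : Option α) = none := by
          intro m
          induction m with
          | zero => rfl
          | succ m ihm => rw [Function.iterate_succ_apply]; exact ihm
        simp only [flip, Option.bind_eq_bind, Option.bind_some, hfa] at h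
        exact absurd ((this n).symm.trans h) (by simp)
      | some c =>
        refine .head hfa (ih ?_)
        simpa [flip, hfa] using h

/-- `f` leads from `a` to `b` in at most `n` steps. -/
def ReachIn {α : Type*} (f : α → Option α) (n : ℕ) (a b : α) : Prop :=
  ∃ m ≤ n, StepsIn f m a b

theorem ReachIn.refl {α : Type*} {f : α → Option α} {n : ℕ} (a : α) : ReachIn f n a a :=
  ⟨0, Nat.zero_le _, .refl a⟩

theorem ReachIn.trans {α : Type*} {f : α → Option α} {n m : ℕ} {a b c : α}
    (h : ReachIn f n a b) (h' : ReachIn f m b c) : ReachIn f (n + m) a c := by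
  obtain ⟨i, hi, h⟩ := h
  obtain ⟨j, hj, h'⟩ := h'
  exact ⟨i + j, Nat.add_le_add hi hj, h.trans h'⟩

theorem ReachIn.head {α : Type*} {f : α → Option α} {n : ℕ} {a b c : α}
    (h : f a = some b) (h' : ReachIn f n b c) : ReachIn f (n + 1) a c := by
  obtain ⟨j, hj, h'⟩ := h'
  exact ⟨j + 1, Nat.add_le_add_right hj 1, .head h h'⟩

theorem ReachIn.mono {α : Type*} {f : α → Option α} {n m : ℕ} {a b : α}
    (h : ReachIn f n a b) (hnm : n ≤ m) : ReachIn f m a b := by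
  obtain ⟨j, hj, h'⟩ := h
  exact ⟨j, hj.trans hnm, h'⟩

theorem ReachIn.cast {α : Type*} {f : α → Option α} {n m : ℕ} {a a' b b' : α}
    (h : ReachIn f n a b) (ha : a = a') (hb : b = b') (hnm : n ≤ m) : ReachIn f m a' b' :=
  ha ▸ hb ▸ h.mono hnm

/-- Running times can then be handled by `ReachIn`, whose bounds add up under transitivity. -/
theorem nonempty_outputsInTime_iff {tm : FinTM2} {l : List (tm.Γ tm.k₀)} {l' : List (tm.Γ tm.k₁)}
    {n : ℕ} : Nonempty (TM2OutputsInTime tm l (some l') n) ↔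
      ReachIn tm.step n (initList tm l) (haltList tm l') := by
  constructor
  · rintro ⟨h⟩
    exact ⟨h.steps, h.steps_le_m, stepsIn_iff_iterate.2 h.evals_in_steps⟩
  · rintro ⟨m, hm, h⟩
    exact ⟨⟨m, stepsIn_iff_iterate.1 h⟩, hm⟩

theorem initList_stk_self (tm : FinTM2) (s : List (tm.Γ tm.k₀)) :
    (initList tm s).stk tm.k₀ = s := by
  simp [initList]

theorem initList_stk_of_ne (tm : FinTM2) (s : List (tm.Γ tm.k₀)) {k : tm.K} (hk : k ≠ tm.k₀) :
    (initList tm s).stk k = [] := by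
  simp [initList, hk]

theorem haltList_stk_self (tm : FinTM2) (s : List (tm.Γ tm.k₁)) :
    (haltList tm s).stk tm.k₁ = s := by
  simp [haltList]

theorem haltList_stk_of_ne (tm : FinTM2) (s : List (tm.Γ tm.k₁)) {k : tm.K} (hk : k ≠ tm.k₁) :
    (haltList tm s).stk k = [] := by
  simp [haltList, hk]

theorem cfg_eq_initList {tm : FinTM2} {s : List (tm.Γ tm.k₀)} {c : tm.Cfg}
    (hl : c.l = some tm.main) (hv : c.var = tm.initialState) (h₀ : c.stk tm.k₀ = s)
    (h : ∀ k, k ≠ tm.k₀ → c.stk k = []) : c = initList tm s := by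
  obtain ⟨l, v, S⟩ := c
  have : S = (initList tm s).stk := by
    funext k
    by_cases hk : k = tm.k₀
    · subst hk; rw [initList_stk_self]; exact h₀
    · rw [initList_stk_of_ne tm s hk]; exact h k hk
  simp only at hl hv
  subst this hl hv
  rfl

theorem cfg_eq_haltList {tm : FinTM2} {s : List (tm.Γ tm.k₁)} {c : tm.Cfg}
    (hl : c.l = none) (hv : c.var = tm.initialState) (h₁ : c.stk tm.k₁ = s)
    (h : ∀ k, k ≠ tm.k₁ → c.stk k = []) : c = haltList tm s := by
  obtain ⟨l, v, S⟩ := c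
  have : S = (haltList tm s).stk := by
    funext k
    by_cases hk : k = tm.k₁
    · subst hk; rw [haltList_stk_self]; exact h₁
    · rw [haltList_stk_of_ne tm s hk]; exact h k hk
  simp only at hl hv
  subst this hl hv
  rfl

/-! ### The output of a machine is not much longer than its running time -/

/-- The largest number of symbols that a statement pushes. -/
def pushCount {K : Type*} {Γ : K → Type*} {Λ σ : Type*} : TM2.Stmt Γ Λ σ → ℕ
  | .push _ _ q => pushCount q + 1
  | .peek _ _ q => pushCount q
  | .pop _ _ q => pushCount q
  | .load _ q => pushCount q
  | .branch _ q q' => max (pushCount q) (pushCount q')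
  | .goto _ => 0
  | .halt => 0

theorem length_stepAux_le {K : Type*} [DecidableEq K] {Γ : K → Type*} {Λ σ : Type*}
    (q : TM2.Stmt Γ Λ σ) (v : σ) (S : ∀ k, List (Γ k)) (k : K) :
    ((TM2.stepAux q v S).stk k).length ≤ (S k).length + pushCount q := by
  induction q generalizing v S with
  | push k' f q ih =>
    refine (ih _ _).trans ?_
    by_cases h : k = k'
    · subst h; simp [pushCount]; omega
    · simp only [pushCount, Function.update_of_ne h]; omega
  | pop k' f q ih =>
    refine (ih _ _).trans ?_
    by_cases h : k = k'
    · subst h; simp [pushCount]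
    · simp [pushCount, Function.update_of_ne h]
  | peek k' f q ih => exact ih _ _
  | load f q ih => exact ih _ _
  | branch f q q' ih ih' =>
    simp only [TM2.stepAux, pushCount]
    cases f v
    · exact (ih' v S).trans (by simp)
    · exact (ih v S).trans (by simp)
  | goto => simp [pushCount]
  | halt => simp [pushCount]

/-- In a composition the second time bound is evaluated at the length of the intermediate word. A
step pushes boundedly many symbols, so this length is controlled by the first running time. The sum
over all labels is a crude uniform bound for one step. -/
theorem exists_length_le (tm : FinTM2) : ∃ b : ℕ, ∀ {n : ℕ} {c d : tm.Cfg} (k : tm.K),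
    StepsIn tm.step n c d → (d.stk k).length ≤ (c.stk k).length + n * b := by
  let := tm.ΛFin
  refine ⟨∑ l, pushCount (tm.m l), fun {n c d} k h => ?_⟩
  induction h with
  | refl => simp
  | @head n c e d h1 _ ih =>
    refine ih.trans ?_
    have : (e.stk k).length ≤ (c.stk k).length + ∑ l, pushCount (tm.m l) := by
      obtain ⟨l, v, S⟩ := c
      cases l with
      | none => simp [FinTM2.step, TM2.step] at h1
      | some l =>
        obtain rfl := Option.some.inj h1
        refine (length_stepAux_le _ _ _ _).trans (Nat.add_le_add_left ?_ _)
        exact Finset.single_le_sum (f := fun l => pushCount (tm.m l)) (fun _ _ => Nat.zero_le _)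
          (Finset.mem_univ l)
    rw [Nat.add_mul]
    omega

theorem polynomial_eval_mono (p : Polynomial ℕ) {a b : ℕ} (h : a ≤ b) : p.eval a ≤ p.eval b := by
  rw [Polynomial.eval_eq_sum, Polynomial.eval_eq_sum]
  exact Finset.sum_le_sum fun i _ => Nat.mul_le_mul_left _ (Nat.pow_le_pow_left h i)

/-! ### Running a machine inside a larger one -/

section Lift

variable {K K' : Type*} {Γ' : K' → Type*} {Λ Λ' σ σ' : Type*}

/-- A statement as a statement of a larger machine: the stacks are renamed by `e`, the labels by
`g`, the state is a component of the larger state, and halting means passing to `exit`. -/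
def liftStmt (e : K → K') (g : Λ → Λ') (get : σ' → σ) (set : σ → σ' → σ') (exit : Option Λ') :
    TM2.Stmt (fun k => Γ' (e k)) Λ σ → TM2.Stmt Γ' Λ' σ'
  | .push k f q => .push (e k) (fun v => f (get v)) (liftStmt e g get set exit q)
  | .peek k f q => .peek (e k) (fun v a => set (f (get v) a) v) (liftStmt e g get set exit q)
  | .pop k f q => .pop (e k) (fun v a => set (f (get v) a) v) (liftStmt e g get set exit q)
  | .load f q => .load (fun v => set (f (get v)) v) (liftStmt e g get set exit q)
  | .branch f q q' =>
    .branch (fun v => f (get v)) (liftStmt e g get set exit q) (liftStmt e g get set exit q')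
  | .goto f => .goto fun v => g (f (get v))
  | .halt => exit.elim .halt fun l => .goto fun _ => l

/-- The configuration `c'` of the larger machine extends `c`; the rest of the state is that of `v₀`
and the remaining stacks are those of `R`. -/
structure CfgExtends (e : K → K') (g : Λ → Λ') (set : σ → σ' → σ') (exit : Option Λ') (v₀ : σ')
    (R : ∀ k, List (Γ' k)) (c : TM2.Cfg (fun k => Γ' (e k)) Λ σ) (c' : TM2.Cfg Γ' Λ' σ') :
    Prop where
  l_eq : c'.l = c.l.elim exit (fun l => some (g l))
  var_eq : c'.var = set c.var v₀
  stk_eq : ∀ k, c'.stk (e k) = c.stk k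
  stk_rest : ∀ k', (∀ k, k' ≠ e k) → c'.stk k' = R k'

variable [DecidableEq K] [DecidableEq K']

theorem stepAux_liftStmt {e : K → K'} (he : Function.Injective e) (g : Λ → Λ') {get : σ' → σ}
    {set : σ → σ' → σ'} (exit : Option Λ') (hgs : ∀ s v, get (set s v) = s)
    (hss : ∀ s s' v, set s (set s' v) = set s v) {v₀ : σ'} {R : ∀ k, List (Γ' k)}
    (q : TM2.Stmt (fun k => Γ' (e k)) Λ σ) (v : σ) (S : ∀ k, List (Γ' (e k)))
    (S' : ∀ k, List (Γ' k)) (hS : ∀ k, S' (e k) = S k) (hR : ∀ k', (∀ k, k' ≠ e k) → S' k' = R k') :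
    CfgExtends e g set exit v₀ R (TM2.stepAux q v S)
      (TM2.stepAux (liftStmt e g get set exit q) (set v v₀) S') := by
  -- Since `e` is injective, updating stack `e k` affects the image of stack `k` only and nothing
  -- outside the range of `e`.
  have hupd : ∀ (S : ∀ k, List (Γ' (e k))) (S' : ∀ k, List (Γ' k)) (_ : ∀ k, S' (e k) = S k)
      (_ : ∀ k', (∀ k, k' ≠ e k) → S' k' = R k') (k : K) (w : List (Γ' (e k))),
      (∀ i, Function.update S' (e k) w (e i) = Function.update S k w i) ∧
      ∀ k', (∀ i, k' ≠ e i) → Function.update S' (e k) w k' = R k' := by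
    intro S S' hS hR k w
    refine ⟨fun i => ?_, fun k' hk' => ?_⟩
    · by_cases h : i = k
      · subst h; simp
      · rw [Function.update_of_ne h, Function.update_of_ne (he.ne h), hS]
    · rw [Function.update_of_ne (hk' k), hR k' hk']
  induction q generalizing v S S' with
  | push k f q ih =>
    simp only [liftStmt, TM2.stepAux, hgs, hS]
    exact ih _ _ _ (hupd S S' hS hR k _).1 (hupd S S' hS hR k _).2
  | peek k f q ih =>
    simp only [liftStmt, TM2.stepAux, hgs, hss, hS]
    exact ih _ _ _ hS hR
  | pop k f q ih =>
    simp only [liftStmt, TM2.stepAux, hgs, hss, hS]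
    exact ih _ _ _ (hupd S S' hS hR k _).1 (hupd S S' hS hR k _).2
  | load f q ih =>
    simp only [liftStmt, TM2.stepAux, hgs, hss]
    exact ih _ _ _ hS hR
  | branch f q q' ih ih' =>
    simp only [liftStmt, TM2.stepAux, hgs]
    cases f v
    · exact ih' _ _ _ hS hR
    · exact ih _ _ _ hS hR
  | goto f =>
    simp only [liftStmt, TM2.stepAux, hgs]
    exact ⟨rfl, rfl, hS, hR⟩
  | halt =>
    cases exit
    · exact ⟨rfl, rfl, hS, hR⟩
    · exact ⟨rfl, rfl, hS, hR⟩

/-- One step of the small machine is one step of the large one. Halting becomes the jump to `exit`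
within the same step, so no steps are added. -/
theorem StepsIn.lift {e : K → K'} (he : Function.Injective e) {g : Λ → Λ'} {get : σ' → σ}
    {set : σ → σ' → σ'} {exit : Option Λ'} (hgs : ∀ s v, get (set s v) = s)
    (hss : ∀ s s' v, set s (set s' v) = set s v) {v₀ : σ'} {R : ∀ k, List (Γ' k)}
    {M : Λ → TM2.Stmt (fun k => Γ' (e k)) Λ σ} {M' : Λ' → TM2.Stmt Γ' Λ' σ'}
    (hM : ∀ l, M' (g l) = liftStmt e g get set exit (M l)) {n : ℕ}
    {c d : TM2.Cfg (fun k => Γ' (e k)) Λ σ} {c' : TM2.Cfg Γ' Λ' σ'}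
    (h : StepsIn (TM2.step M) n c d) (hc : CfgExtends e g set exit v₀ R c c') :
    ∃ d', StepsIn (TM2.step M') n c' d' ∧ CfgExtends e g set exit v₀ R d d' := by
  induction h generalizing c' with
  | refl => exact ⟨c', .refl _, hc⟩
  | @head n c b d h1 _ ih =>
    obtain ⟨l, v, S⟩ := c
    obtain ⟨l', v', S'⟩ := c'
    cases l with
    | none => simp [TM2.step] at h1
    | some l =>
      simp only [TM2.step, Option.some.injEq] at h1
      have h2 := hc.l_eq
      have h3 := hc.var_eq
      simp only [Option.elim_some] at h2 h3
      subst h2 h3 h1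
      obtain ⟨d', hd, hd'⟩ := ih (stepAux_liftStmt he g exit hgs hss (M l) v S S' hc.stk_eq
        hc.stk_rest)
      exact ⟨d', .head (by simp only [TM2.step, hM]) hd, hd'⟩

end Lift

/-! ### Composition of polynomial-time functions -/

/-- A loop that pops a stack and pushes the images of the symbols onto another one. -/
theorem exists_stepsIn_move {K : Type*} [DecidableEq K] {Γ : K → Type*} {Λ σ δ : Type*}
    [Inhabited δ] {M : Λ → TM2.Stmt Γ Λ σ} {a b : K} (hab : a ≠ b) {l l' : Λ} {get : σ → Option δ}
    {set : Option δ → σ → σ} (hgs : ∀ s v, get (set s v) = s)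
    (hss : ∀ s s' v, set s (set s' v) = set s v) {φ : Γ a → δ} {ψ : δ → Γ b}
    (hM : M l = .pop a (fun v x => set (x.map φ) v) (.branch (fun v => (get v).isSome)
      (.push b (fun v => ψ ((get v).getD default)) (.goto fun _ => l)) (.goto fun _ => l')))
    (w : List (Γ a)) (v : σ) (S : ∀ k, List (Γ k)) (hw : S a = w) :
    ∃ S', StepsIn (TM2.step M) (w.length + 1) ⟨some l, v, S⟩ ⟨some l', set none v, S'⟩ ∧
      S' a = [] ∧ S' b = (w.map fun x => ψ (φ x)).reverse ++ S b ∧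
      ∀ k, k ≠ a → k ≠ b → S' k = S k := by
  induction w generalizing v S with
  | nil =>
    refine ⟨Function.update S a [], .head (b := ⟨_, _, _⟩) ?_ (.refl _), ?_, ?_, ?_⟩
    · simp [TM2.step, hM, hw, hgs]
    · simp
    · simp [hab.symm]
    · intro k hk _
      simp [hk]
  | cons x w ih =>
    obtain ⟨S', h, h1, h2, h3⟩ := ih (set (some (φ x)) v)
      (Function.update (Function.update S a w) b (ψ (φ x) :: S b)) (by simp [hab])
    rw [hss] at h
    refine ⟨S', .head ?_ h, h1, ?_, ?_⟩
    · simp [TM2.step, hM, hw, hgs, hab.symm]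
    · rw [h2]; simp
    · intro k hk hk'
      rw [h3 k hk hk']
      simp [hk, hk']

section Comp

variable (M₁ M₂ : FinTM2) {β : Type} (out : M₁.Γ M₁.k₁ ≃ β) (inp : M₂.Γ M₂.k₀ ≃ β)

/-- The stack alphabets of the composition of two machines. -/
@[reducible]
def compΓ (β : Type) : M₁.K ⊕ M₂.K ⊕ Unit → Type
  | .inl k => M₁.Γ k
  | .inr (.inl k) => M₂.Γ k
  | .inr (.inr _) => β

/-- The program of the composition of two machines: run `M₁`, move its output to a temporary
stack and from there to the input stack of `M₂`, run `M₂`. -/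
def compProgram [Inhabited β] : M₁.Λ ⊕ M₂.Λ ⊕ Bool →
    TM2.Stmt (compΓ M₁ M₂ β) (M₁.Λ ⊕ M₂.Λ ⊕ Bool) (M₁.σ × M₂.σ × Option β)
  | .inl l =>
    liftStmt (Γ' := compΓ M₁ M₂ β) (σ' := M₁.σ × M₂.σ × Option β) Sum.inl Sum.inl Prod.fst
      (fun s v => (s, v.2)) (some (.inr (.inr false))) (M₁.m l)
  | .inr (.inl l) =>
    liftStmt (Γ' := compΓ M₁ M₂ β) (σ' := M₁.σ × M₂.σ × Option β) (fun k => Sum.inr (Sum.inl k))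
      (fun l => Sum.inr (Sum.inl l)) (fun v => v.2.1) (fun s v => (v.1, s, v.2.2)) none (M₂.m l)
  | .inr (.inr false) =>
    .pop (.inl M₁.k₁) (fun v a => (v.1, v.2.1, a.map (α := M₁.Γ M₁.k₁) out)) <|
    .branch (fun v => v.2.2.isSome)
      -- The default value is never used: this branch is taken only after a symbol was popped.
      (.push (.inr (.inr ())) (fun v => (v.2.2.getD default : β)) <|
        .goto fun _ => .inr (.inr false))
      (.goto fun _ => .inr (.inr true))
  | .inr (.inr true) =>
    .pop (.inr (.inr ())) (fun v a => (v.1, v.2.1, a.map (α := β) id)) <|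
    .branch (fun v => v.2.2.isSome)
      (.push (.inr (.inl M₂.k₀)) (fun v => inp.symm (v.2.2.getD default)) <|
        .goto fun _ => .inr (.inr true))
      (.goto fun _ => .inr (.inl M₂.main))

/-- The composition of two machines. -/
def compMachine [Inhabited β] : FinTM2 :=
  letI := M₁.kFin
  letI := M₂.kFin
  letI := M₁.ΛFin
  letI := M₂.ΛFin
  letI := M₁.σFin
  letI := M₂.σFin
  letI := M₁.Γk₀Fin
  letI := M₂.Γk₀Fin
  letI : Fintype β := Fintype.ofEquiv _ inp
  { K := M₁.K ⊕ M₂.K ⊕ Unit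
    k₀ := .inl M₁.k₀
    k₁ := .inr (.inl M₂.k₁)
    Γ := compΓ M₁ M₂ β
    Λ := M₁.Λ ⊕ M₂.Λ ⊕ Bool
    main := .inl M₁.main
    σ := M₁.σ × M₂.σ × Option β
    initialState := (M₁.initialState, M₂.initialState, none)
    Γk₀Fin := M₁.Γk₀Fin
    m := compProgram M₁ M₂ out inp }

variable [Inhabited β]

/-- A move between stacks reverses the word, so two moves through the temporary stack restore it;
they cost `2 * (w.length + 1)`. Since `haltList` prescribes the initial state and empty stacks apart
from the output, nothing else is left over from the first run. -/
theorem compMachine_reachIn {n m : ℕ} {x : List (M₁.Γ M₁.k₀)} {w : List β}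
    {z : List (M₂.Γ M₂.k₁)}
    (h₁ : ReachIn M₁.step n (initList M₁ x) (haltList M₁ (w.map out.symm)))
    (h₂ : ReachIn M₂.step m (initList M₂ (w.map inp.symm)) (haltList M₂ z)) :
    ReachIn (compMachine M₁ M₂ out inp).step (n + m + 2 * (w.length + 1))
      (initList (compMachine M₁ M₂ out inp) x) (haltList (compMachine M₁ M₂ out inp) z) := by
  obtain ⟨n', hn, h₁⟩ := h₁
  obtain ⟨m', hm, h₂⟩ := h₂
  set M := compMachine M₁ M₂ out inp with hM
  have inj₁ : Function.Injective (Sum.inl : M₁.K → M₁.K ⊕ M₂.K ⊕ Unit) := Sum.inl_injective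
  have inj₂ : Function.Injective (fun k : M₂.K => (Sum.inr (Sum.inl k) : M₁.K ⊕ M₂.K ⊕ Unit)) :=
    Sum.inr_injective.comp Sum.inl_injective
  obtain ⟨⟨l, v, S⟩, hd, hd'⟩ := StepsIn.lift (Γ' := compΓ M₁ M₂ β) inj₁ (g := Sum.inl)
    (get := fun v : M₁.σ × M₂.σ × Option β => v.1) (set := fun s v => (s, v.2))
    (exit := some (.inr (.inr false))) (fun _ _ => rfl) (fun _ _ _ => rfl)
    (v₀ := (M₁.initialState, M₂.initialState, none)) (R := fun _ => []) (M := M₁.m)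
    (M' := compProgram M₁ M₂ out inp) (fun _ => rfl) h₁ (c' := initList M x)
    { l_eq := rfl
      var_eq := rfl
      stk_eq := fun k => by
        by_cases hk : k = M₁.k₀
        · subst hk
          rw [initList_stk_self]
          exact initList_stk_self M x
        · rw [initList_stk_of_ne M₁ x hk]
          exact initList_stk_of_ne M x (inj₁.ne hk)
      stk_rest := fun k hk => initList_stk_of_ne M x (hk _) }
  obtain ⟨rfl, rfl, hk, hr⟩ := hd'
  simp only at hk hr
  obtain ⟨S', hu, hu1, hu2, hu3⟩ := exists_stepsIn_move (Γ := compΓ M₁ M₂ β)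
    (M := compProgram M₁ M₂ out inp) (a := .inl M₁.k₁) (b := .inr (.inr ())) (by simp)
    (l := .inr (.inr false)) (l' := .inr (.inr true)) (get := fun v => v.2.2)
    (set := fun s v => (v.1, v.2.1, s)) (fun _ _ => rfl) (fun _ _ _ => rfl) (φ := out) (ψ := id)
    rfl (w.map out.symm) (M₁.initialState, M₂.initialState, none) S
    (by rw [hk]; exact haltList_stk_self _ _)
  obtain ⟨S'', hl, hl1, hl2, hl3⟩ := exists_stepsIn_move (Γ := compΓ M₁ M₂ β)
    (M := compProgram M₁ M₂ out inp) (a := .inr (.inr ())) (b := .inr (.inl M₂.k₀)) (by simp)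
    (l := .inr (.inr true)) (l' := .inr (.inl M₂.main)) (get := fun v => v.2.2)
    (set := fun s v => (v.1, v.2.1, s)) (fun _ _ => rfl) (fun _ _ _ => rfl) (φ := id)
    (ψ := inp.symm) rfl w.reverse (M₁.initialState, M₂.initialState, none) S'
    (by rw [hu2, hr _ (by simp)]; simp)
  have hS0 : S'' (.inr (.inl M₂.k₀)) = w.map inp.symm := by
    rw [hl2, hu3 _ (by simp) (by simp), hr _ (by simp)]
    simp
  have hS1 : ∀ k, k ≠ .inr (.inl M₂.k₀) → S'' k = [] := by
    intro k hk0
    by_cases h1 : k = .inr (.inr ())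
    · rw [h1, hl1]
    rw [hl3 k h1 hk0]
    by_cases h2 : k = .inl M₁.k₁
    · rw [h2, hu1]
    rw [hu3 k h2 h1]
    rcases k with k | k | k
    · rw [hk]
      exact haltList_stk_of_ne _ _ (fun h => h2 (by rw [h]))
    · exact hr _ (by simp)
    · exact hr _ (by simp)
  obtain ⟨⟨l, v, T⟩, he, he'⟩ := StepsIn.lift (Γ' := compΓ M₁ M₂ β) inj₂
    (g := fun l => Sum.inr (Sum.inl l))
    (get := fun v : M₁.σ × M₂.σ × Option β => v.2.1) (set := fun s v => (v.1, s, v.2.2))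
    (exit := none) (fun _ _ => rfl) (fun _ _ _ => rfl)
    (v₀ := (M₁.initialState, M₂.initialState, none)) (R := fun _ => []) (M := M₂.m)
    (M' := compProgram M₁ M₂ out inp) (fun _ => rfl) h₂
    (c' := ⟨some (.inr (.inl M₂.main)), (M₁.initialState, M₂.initialState, none), S''⟩)
    { l_eq := rfl
      var_eq := rfl
      stk_eq := fun k => by
        by_cases hk : k = M₂.k₀
        · subst hk
          rw [initList_stk_self]
          exact hS0
        · rw [initList_stk_of_ne M₂ _ hk]
          exact hS1 _ (inj₂.ne hk)
      stk_rest := fun k hk => hS1 _ (hk _) }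
  obtain ⟨rfl, rfl, hk', hr'⟩ := he'
  simp only at hk' hr'
  refine ⟨n' + (w.length + 1) + (w.length + 1) + m', by omega, ?_⟩
  have hend : (⟨none, (M₁.initialState, M₂.initialState, none), T⟩ : M.Cfg) = haltList M z := by
    refine cfg_eq_haltList rfl rfl ?_ ?_
    · exact (hk' _).trans (haltList_stk_self _ _)
    · rintro (k | k | k) hk0
      · exact hr' _ (by simp)
      · exact (hk' _).trans (haltList_stk_of_ne _ _ (fun h => hk0 (by rw [h]; rfl)))
      · exact hr' _ (by simp)
  rw [← hend]
  simp only [List.length_map, List.length_reverse] at hu hl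
  exact ((hd.trans hu).trans hl).trans he

end Comp

/-- The composition of two polynomial-time functions is computable in polynomial time. -/
theorem polyTime_comp {α β γ αΓ βΓ γΓ : Type} [Inhabited βΓ] {eα : α → List αΓ}
    {eβ : β → List βΓ} {eγ : γ → List γΓ} {f : α → β} {g : β → γ}
    (h₁ : Nonempty (TM2ComputableInPolyTime eα eβ f))
    (h₂ : Nonempty (TM2ComputableInPolyTime eβ eγ g)) :
    Nonempty (TM2ComputableInPolyTime eα eγ (g ∘ f)) := by
  obtain ⟨⟨⟨M₁, i₁, o₁⟩, p₁, H₁⟩⟩ := h₁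
  obtain ⟨⟨⟨M₂, i₂, o₂⟩, p₂, H₂⟩⟩ := h₂
  obtain ⟨b, hb⟩ := exists_length_le M₁
  let q : Polynomial ℕ := Polynomial.X + p₁ * Polynomial.C b
  let time : Polynomial ℕ := p₁ + p₂.comp q + 2 * (q + 1)
  have key : ∀ a, Nonempty (TM2OutputsInTime (compMachine M₁ M₂ o₁ i₂)
      ((eα a).map i₁.symm) (some ((eγ (g (f a))).map o₂.symm)) (time.eval (eα a).length)) := by
    intro a
    have h1 := nonempty_outputsInTime_iff.1 ⟨H₁ a⟩
    have h2 := nonempty_outputsInTime_iff.1 ⟨H₂ (f a)⟩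
    refine nonempty_outputsInTime_iff.2 ((compMachine_reachIn M₁ M₂ o₁ i₂ h1 h2).mono ?_)
    have hlen : (eβ (f a)).length ≤ q.eval (eα a).length := by
      obtain ⟨n, hn, h⟩ := h1
      have := hb M₁.k₁ h
      rw [haltList_stk_self] at this
      simp only [List.length_map] at this
      -- The output stack of `M₁` may be its input stack and then starts with the whole input; hence
      -- the summand `X` in `q`.
      have h0 : ((initList M₁ ((eα a).map i₁.invFun)).stk M₁.k₁).length ≤ (eα a).length := by
        by_cases hk : M₁.k₁ = M₁.k₀
        · rw [hk, initList_stk_self]; simp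
        · rw [initList_stk_of_ne _ _ hk]; simp
      simp only [q, Polynomial.eval_add, Polynomial.eval_X, Polynomial.eval_mul, Polynomial.eval_C]
      have := Nat.mul_le_mul_right b hn
      omega
    have := polynomial_eval_mono p₂ hlen
    simp only [time, Polynomial.eval_add, Polynomial.eval_comp, Polynomial.eval_mul,
      Polynomial.eval_one, Polynomial.eval_ofNat]
    omega
  exact ⟨⟨⟨compMachine M₁ M₂ o₁ i₂, i₁, o₂⟩, time, fun a => (key a).some⟩⟩

/-- Only the words that encode inputs and outputs matter. -/
theorem polyTime_congr {α β α' β' αΓ βΓ : Type} {eα : α → List αΓ} {eβ : β → List βΓ}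
    {eα' : α' → List αΓ} {eβ' : β' → List βΓ} {f : α → β} {g : α' → β'} (φ : α' → α)
    (hin : ∀ a, eα (φ a) = eα' a) (hout : ∀ a, eβ (f (φ a)) = eβ' (g a))
    (h : Nonempty (TM2ComputableInPolyTime eα eβ f)) :
    Nonempty (TM2ComputableInPolyTime eα' eβ' g) := by
  obtain ⟨⟨M, p, H⟩⟩ := h
  refine ⟨⟨M, p, fun a => ?_⟩⟩
  rw [← hin, ← hout]
  exact H (φ a)

/-! ### Machines with four stacks

A convenient form of machines: an input stack, an output stack and two working stacks. One
instruction pushes words, then pops symbols, and chooses the next label. -/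

/-- An instruction: words to be pushed, stacks to be popped, and the next label (or halting) as a
function of the popped symbols. -/
structure Instr (A B X Y Λ : Type) where
  pushOut : List B := []
  pushX : List X := []
  pushY : List Y := []
  popInp : Bool := false
  popOut : Bool := false
  popX : Bool := false
  popY : Bool := false
  next : Option A → Option B → Option X → Option Y → Option Λ

/-- A configuration of a machine with four stacks. -/
structure Conf (A B X Y Λ : Type) where
  l : Option Λ
  inp : List A
  out : List B
  x : List X
  y : List Y

section Machine

variable {A B X Y Λ : Type}

/-- The symbol that is seen when a stack is popped, if it is. -/
def headIf {A : Type*} (b : Bool) (w : List A) : Option A := if b then w.head? else none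

/-- The stack after it is popped, if it is. -/
def tailIf {A : Type*} (b : Bool) (w : List A) : List A := if b then w.tail else w

/-- One step of a machine with four stacks. -/
def Instr.step (M : Λ → Instr A B X Y Λ) : Conf A B X Y Λ → Option (Conf A B X Y Λ)
  | ⟨none, _, _, _, _⟩ => none
  | ⟨some l, i, o, x, y⟩ => some
    ⟨(M l).next (headIf (M l).popInp i) (headIf (M l).popOut ((M l).pushOut ++ o))
        (headIf (M l).popX ((M l).pushX ++ x)) (headIf (M l).popY ((M l).pushY ++ y)),
      tailIf (M l).popInp i, tailIf (M l).popOut ((M l).pushOut ++ o),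
      tailIf (M l).popX ((M l).pushX ++ x), tailIf (M l).popY ((M l).pushY ++ y)⟩

/-- The indices of the four stacks. -/
inductive StackIdx
  | inp | out | x | y
  deriving DecidableEq

instance : Fintype StackIdx := ⟨{.inp, .out, .x, .y}, fun k => by cases k <;> simp⟩

/-- The alphabets of the four stacks. -/
@[reducible]
def stackΓ (A B X Y : Type) : StackIdx → Type
  | .inp => A
  | .out => B
  | .x => X
  | .y => Y

/-- Four words as contents of the four stacks. -/
def stackWords (i : List A) (o : List B) (x : List X) (y : List Y) : ∀ k, List (stackΓ A B X Y k)
  | .inp => i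
  | .out => o
  | .x => x
  | .y => y

theorem update_stackWords_inp (i : List A) (o : List B) (x : List X) (y : List Y) (w : List A) :
    Function.update (stackWords i o x y) .inp w = stackWords w o x y := by
  funext k; cases k <;> rfl

theorem update_stackWords_out (i : List A) (o : List B) (x : List X) (y : List Y) (w : List B) :
    Function.update (stackWords i o x y) .out w = stackWords i w x y := by
  funext k; cases k <;> rfl

theorem update_stackWords_x (i : List A) (o : List B) (x : List X) (y : List Y) (w : List X) :
    Function.update (stackWords i o x y) .x w = stackWords i o w y := by
  funext k; cases k <;> rfl

theorem update_stackWords_y (i : List A) (o : List B) (x : List X) (y : List Y) (w : List Y) :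
    Function.update (stackWords i o x y) .y w = stackWords i o x w := by
  funext k; cases k <;> rfl

/-! ### Pushing words and optional popping as statements of a Turing machine -/

section Stmt

variable {K : Type*} {Γ : K → Type*} {L σ : Type*}

/-- The statement that pushes a word. -/
def pushAll (k : K) : List (Γ k) → TM2.Stmt Γ L σ → TM2.Stmt Γ L σ
  | [], q => q
  | a :: w, q => pushAll k w (.push k (fun _ => a) q)

/-- The statement that pops a stack if `b` holds. -/
def popIf (k : K) (b : Bool) (f : σ → Option (Γ k) → σ) (q : TM2.Stmt Γ L σ) : TM2.Stmt Γ L σ :=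
  if b then .pop k f q else q

variable [DecidableEq K]

theorem stepAux_pushAll (k : K) (w : List (Γ k)) (q : TM2.Stmt Γ L σ) (v : σ)
    (S : ∀ k, List (Γ k)) :
    TM2.stepAux (pushAll k w q) v S = TM2.stepAux q v (Function.update S k (w ++ S k)) := by
  induction w generalizing q with
  | nil => simp [pushAll]
  | cons a w ih => simp [pushAll, ih]

theorem stepAux_popIf (k : K) (b : Bool) (f : σ → Option (Γ k) → σ) (q : TM2.Stmt Γ L σ) (v : σ)
    (hf : f v none = v) (S : ∀ k, List (Γ k)) :
    TM2.stepAux (popIf k b f q) v S =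
      TM2.stepAux q (f v (headIf b (S k))) (Function.update S k (tailIf b (S k))) := by
  cases b <;> simp [popIf, headIf, tailIf, hf]

end Stmt

/-- The registers that hold the popped symbols. -/
abbrev Registers (A B X Y : Type) : Type := Option A × Option B × Option X × Option Y

/-- An instruction as a statement of a Turing machine. -/
def Instr.toStmt (l : Λ) (I : Instr A B X Y Λ) :
    TM2.Stmt (stackΓ A B X Y) Λ (Registers A B X Y) :=
  .load (fun _ => (none, none, none, none)) <|
  pushAll .out I.pushOut <| pushAll .x I.pushX <| pushAll .y I.pushY <|
  popIf .inp I.popInp (fun v a => (a, v.2)) <|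
  popIf .out I.popOut (fun v a => (v.1, a, v.2.2)) <|
  popIf .x I.popX (fun v a => (v.1, v.2.1, a, v.2.2.2)) <|
  popIf .y I.popY (fun v a => (v.1, v.2.1, v.2.2.1, a)) <|
  .branch (fun v => (I.next v.1 v.2.1 v.2.2.1 v.2.2.2).isSome)
    (.goto fun v => (I.next v.1 v.2.1 v.2.2.1 v.2.2.2).getD l)
    -- A halting configuration must carry the initial state, so the registers are cleared once more.
    (.load (fun _ => (none, none, none, none)) .halt)

/-- Every instruction starts by clearing the registers, so what they hold afterwards matters only on
halting. -/
theorem stepAux_toStmt (l : Λ) (I : Instr A B X Y Λ) (v : Registers A B X Y) (i : List A)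
    (o : List B) (x : List X) (y : List Y) : ∃ v',
    TM2.stepAux (I.toStmt l) v (stackWords i o x y) =
      ⟨I.next (headIf I.popInp i) (headIf I.popOut (I.pushOut ++ o))
        (headIf I.popX (I.pushX ++ x)) (headIf I.popY (I.pushY ++ y)), v',
        stackWords (tailIf I.popInp i) (tailIf I.popOut (I.pushOut ++ o))
          (tailIf I.popX (I.pushX ++ x)) (tailIf I.popY (I.pushY ++ y))⟩ ∧
      (I.next (headIf I.popInp i) (headIf I.popOut (I.pushOut ++ o))
        (headIf I.popX (I.pushX ++ x)) (headIf I.popY (I.pushY ++ y)) = none →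
        v' = (none, none, none, none)) := by
  simp only [Instr.toStmt, TM2.stepAux, stepAux_pushAll, stepAux_popIf, update_stackWords_inp,
    update_stackWords_out, update_stackWords_x, update_stackWords_y]
  simp only [stackWords]
  cases h : I.next (headIf I.popInp i) (headIf I.popOut (I.pushOut ++ o))
        (headIf I.popX (I.pushX ++ x)) (headIf I.popY (I.pushY ++ y)) with
  | none => exact ⟨_, rfl, fun _ => rfl⟩
  | some l' => exact ⟨_, rfl, fun h => by simp at h⟩

/-- A machine with four stacks as a Turing machine. -/
def Instr.toMachine [Fintype A] [Fintype B] [Fintype X] [Fintype Y] [Fintype Λ]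
    (M : Λ → Instr A B X Y Λ) (main : Λ) : FinTM2 where
  K := StackIdx
  k₀ := .inp
  k₁ := .out
  Γ := stackΓ A B X Y
  Λ := Λ
  main := main
  σ := Registers A B X Y
  initialState := (none, none, none, none)
  Γk₀Fin := inferInstanceAs (Fintype A)
  m l := (M l).toStmt l

theorem stepsIn_toMachine [Fintype A] [Fintype B] [Fintype X] [Fintype Y] [Fintype Λ]
    {M : Λ → Instr A B X Y Λ} {main : Λ} {n : ℕ} {c : Conf A B X Y Λ} {o : List B}
    (h : StepsIn (Instr.step M) n c ⟨none, [], o, [], []⟩) (v : Registers A B X Y)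
    (hv : c.l = none → v = (none, none, none, none)) :
    StepsIn (Instr.toMachine M main).step n
      (⟨c.l, v, stackWords c.inp c.out c.x c.y⟩ : TM2.Cfg _ _ _)
      (⟨none, (none, none, none, none), stackWords [] o [] []⟩ : TM2.Cfg _ _ _) := by
  generalize hd : (⟨none, [], o, [], []⟩ : Conf A B X Y Λ) = d at h
  induction h generalizing v with
  | refl c =>
    subst hd
    rw [hv rfl]
    exact .refl _
  | @head n c b d h1 _ ih =>
    obtain ⟨l, i, o', x, y⟩ := c
    cases l with
    | none => simp [Instr.step] at h1
    | some l =>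
      obtain rfl := Option.some.inj h1
      obtain ⟨v', h2, h3⟩ := stepAux_toStmt l (M l) v i o' x y
      exact .head (congrArg some h2) (ih v' h3 hd)

/-- A machine with four stacks that runs in linear time computes a function in polynomial time. -/
theorem polyTime_of_machine {α β : Type} {eα : α → List A} {eβ : β → List B} {f : α → β}
    [Finite A] [Finite B] [Finite X] [Finite Y] [Finite Λ] (M : Λ → Instr A B X Y Λ) (main : Λ)
    (C : ℕ) (h : ∀ a, ReachIn (Instr.step M) (C * ((eα a).length + 1))
      ⟨some main, eα a, [], [], []⟩ ⟨none, [], eβ (f a), [], []⟩) :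
    Nonempty (TM2ComputableInPolyTime eα eβ f) := by
  have := Fintype.ofFinite A
  have := Fintype.ofFinite B
  have := Fintype.ofFinite X
  have := Fintype.ofFinite Y
  have := Fintype.ofFinite Λ
  have key : ∀ a, Nonempty (TM2OutputsInTime (Instr.toMachine M main) (eα a)
      (some (eβ (f a))) ((Polynomial.C C * (Polynomial.X + 1)).eval (eα a).length)) := by
    intro a
    refine nonempty_outputsInTime_iff.2 ?_
    obtain ⟨n, hn, h⟩ := h a
    refine ⟨n, by simpa using hn, ?_⟩
    have h := stepsIn_toMachine (main := main) h (none, none, none, none) (fun _ => rfl)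
    have h1 : (⟨some main, (none, none, none, none), stackWords (eα a) [] [] []⟩ :
        (Instr.toMachine M main).Cfg) = initList (Instr.toMachine M main) (eα a) := by
      refine cfg_eq_initList rfl rfl rfl ?_
      intro k hk
      cases k
      · exact absurd rfl hk
      all_goals rfl
    have h2 : (⟨none, (none, none, none, none), stackWords [] (eβ (f a)) [] []⟩ :
        (Instr.toMachine M main).Cfg) = haltList (Instr.toMachine M main) (eβ (f a)) := by
      refine cfg_eq_haltList rfl rfl rfl ?_
      intro k hk
      cases k
      on_goal 2 => exact absurd rfl hk
      all_goals rfl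
    rw [← h1, ← h2]
    exact h
  refine ⟨⟨⟨Instr.toMachine M main, Equiv.refl A, Equiv.refl B⟩,
    Polynomial.C C * (Polynomial.X + 1), fun a => ?_⟩⟩
  exact (congrArg₂ (fun (u : List A) (w : List B) =>
    TM2OutputsInTime (Instr.toMachine M main) u (some w) _) (List.map_id _) (List.map_id _)).mpr
    (key a).some

/-! ### Reversing words -/

/-- The machine that reverses a word. The label carries the symbol that is to be written. -/
def reverseProgram (A : Type) (a : Option A) : Instr A A Unit Unit (Option A) where
  pushOut := a.toList
  popInp := true
  next b _ _ _ := b.map some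

theorem reverseProgram_reachIn (w : List A) (a : Option A) (o : List A) :
    ReachIn (Instr.step (reverseProgram A)) (w.length + 1) ⟨some a, w, o, [], []⟩
      ⟨none, [], w.reverse ++ (a.toList ++ o), [], []⟩ := by
  induction w generalizing a o with
  | nil => exact .head rfl (.refl _)
  | cons b w ih =>
    have h : ReachIn (Instr.step (reverseProgram A)) _ ⟨some a, b :: w, o, [], []⟩ _ :=
      .head rfl (ih (some b) (a.toList ++ o))
    simpa using h

/-- A function is computable in polynomial time if its reversal is. -/
theorem polyTime_of_reverse {α β αΓ βΓ : Type} [Finite βΓ] [Inhabited βΓ] {eα : α → List αΓ}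
    {eβ : β → List βΓ} {f : α → β}
    (h : Nonempty (TM2ComputableInPolyTime eα (fun b => (eβ b).reverse) f)) :
    Nonempty (TM2ComputableInPolyTime eα eβ f) := by
  -- A machine that writes its output on a stack, first symbol first, ends up with the reversed
  -- word; one more pass repairs this.
  refine polyTime_comp (g := id) h (polyTime_of_machine (reverseProgram βΓ) none 1 fun b => ?_)
  simpa using reverseProgram_reachIn (eβ b).reverse none []

end Machine

/-! ### Marking the diagonal of an adjacency matrix -/

/-- The relation between two vertices of a graph: they are equal, adjacent or neither. -/
inductive Mark
  | diag | edge | non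
  deriving DecidableEq

instance : Fintype Mark := ⟨{.diag, .edge, .non}, fun k => by cases k <;> simp⟩

/-- The mark of an off-diagonal entry of an adjacency matrix. -/
def markOfBool (b : Bool) : Mark := if b then .edge else .non

/-- The word of a list of rows: every row is followed by `none`. -/
def rowsWord {M : Type} (rows : List (List M)) : List (Option M) :=
  rows.flatMap fun r => r.map some ++ [none]

/-- The labels of the marking machine. -/
inductive MarkLabel
  | cell (past : Bool)
  | mark (b past : Bool)
  | emit (m : Mark) (count past : Bool)
  | endRow
  | restore
  | last (b : Bool)
  | finish
  deriving Fintype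

/-- The marking machine. The first working stack holds as many symbols as rows have been read. -/
def markProgram : MarkLabel → Instr Γ' (Option Mark) Unit Unit MarkLabel
  | .cell past =>
    { popInp := true
      next := fun a _ _ _ => match a with
        | some (Γ'.bit b) => some (.mark b past)
        | some Γ'.ket => some .endRow
        | _ => some (.last false) }
  | .mark b past =>
    { popInp := true
      popX := true
      next := fun _ _ x _ => match x, past with
        | some _, _ => some (.emit (markOfBool b) true past)
        | none, true => some (.emit (markOfBool b) false true)
        -- In row `v` the counter of `v` symbols is found empty for the first time exactly at column
        -- `v`.
        | none, false => some (.emit .diag false true) }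
  | .emit m count past =>
    { pushOut := [some m]
      pushY := if count then [()] else []
      next := fun _ _ _ _ => some (.cell past) }
  | .endRow =>
    -- The head of the pushed list ends on top, so the output receives first the entry of the added
    -- isolated vertex and then the end of the row. The extra symbol on the first working stack
    -- counts the finished row.
    { pushOut := [none, some Mark.non]
      pushX := [()]
      popY := true
      next := fun _ _ _ y => match y with
        | some _ => some .restore
        | none => some (.cell false) }
  | .restore =>
    { pushX := [()]
      popY := true
      next := fun _ _ _ y => match y with
        | some _ => some .restore
        | none => some (.cell false) }
  | .last b =>
    { pushOut := if b then [some Mark.non] else []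
      popX := true
      next := fun _ _ x _ => match x with
        | some _ => some (.last true)
        | none => some .finish }
  | .finish =>
    { pushOut := [none, some .diag]
      next := fun _ _ _ _ => none }

/-- The word of a row of bits. -/
def bitsWord (bs : List Bool) : List Γ' := bs.flatMap fun b => [Γ'.bit b, Γ'.comma]

theorem markProgram_before (bs : List Bool) (rest : List Γ') (o : List (Option Mark))
    (x y : List Unit) :
    ReachIn (Instr.step markProgram) (3 * bs.length)
      ⟨some (.cell false), bitsWord bs ++ rest, o, List.replicate bs.length () ++ x, y⟩
      ⟨some (.cell false), rest, (bs.map fun b => some (markOfBool b)).reverse ++ o, x,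
        List.replicate bs.length () ++ y⟩ := by
  induction bs generalizing o y with
  | nil => exact .refl _
  | cons b bs ih =>
    have h : ReachIn (Instr.step markProgram) _
        ⟨some (.cell false), bitsWord (b :: bs) ++ rest, o,
          List.replicate (bs.length + 1) () ++ x, y⟩ _ :=
      .head rfl (.head rfl (.head rfl (ih (some (markOfBool b) :: o) (() :: y))))
    refine h.cast rfl ?_ (by simp; omega)
    rw [List.length_cons, List.replicate_succ']
    simp

theorem markProgram_after (bs : List Bool) (rest : List Γ') (o : List (Option Mark))
    (y : List Unit) :
    ReachIn (Instr.step markProgram) (3 * bs.length)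
      ⟨some (.cell true), bitsWord bs ++ rest, o, [], y⟩
      ⟨some (.cell true), rest, (bs.map fun b => some (markOfBool b)).reverse ++ o, [], y⟩ := by
  induction bs generalizing o with
  | nil => exact .refl _
  | cons b bs ih =>
    have h : ReachIn (Instr.step markProgram) _
        ⟨some (.cell true), bitsWord (b :: bs) ++ rest, o, [], y⟩ _ :=
      .head rfl (.head rfl (.head rfl (ih (some (markOfBool b) :: o))))
    exact h.cast rfl (by simp) (by simp; omega)

theorem markProgram_restore (v : ℕ) (w : List Γ') (o : List (Option Mark)) (x : List Unit) :
    ReachIn (Instr.step markProgram) (v + 1)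
      ⟨some .restore, w, o, x, List.replicate v ()⟩
      ⟨some (.cell false), w, o, List.replicate (v + 1) () ++ x, []⟩ := by
  induction v generalizing x with
  | zero => exact .head rfl (.refl _)
  | succ v ih =>
    have h : ReachIn (Instr.step markProgram) _
        ⟨some .restore, w, o, x, List.replicate (v + 1) ()⟩ _ := .head rfl (ih (() :: x))
    convert h using 2
    rw [List.replicate_succ']; simp

theorem markProgram_endRow (v : ℕ) (w : List Γ') (o : List (Option Mark)) :
    ReachIn (Instr.step markProgram) (v + 1)
      ⟨some .endRow, w, o, [], List.replicate v ()⟩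
      ⟨some (.cell false), w, none :: some Mark.non :: o, List.replicate (v + 1) (), []⟩ := by
  cases v with
  | zero => exact .head rfl (.refl _)
  | succ v =>
    have h : ReachIn (Instr.step markProgram) _
        ⟨some .endRow, w, o, [], List.replicate (v + 1) ()⟩ _ :=
      .head rfl (markProgram_restore v w (none :: some Mark.non :: o) [()])
    convert h using 2
    rw [List.replicate_succ']

/-- The marks of a row whose diagonal entry is at position `v`. -/
def markRow (v : ℕ) (bs : List Bool) : List Mark :=
  (bs.take v).map markOfBool ++ .diag :: (bs.drop (v + 1)).map markOfBool

/-- The row splits at its diagonal entry: `v` cells move the counter to the second stack, one cell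
finds it empty, the remaining cells leave both stacks alone, and the end of the row restores the
counter plus one. -/
theorem markProgram_row (v : ℕ) (bs : List Bool) (hv : v < bs.length) (rest : List Γ')
    (o : List (Option Mark)) :
    ReachIn (Instr.step markProgram) (4 * bs.length + 5)
      ⟨some (.cell false), bitsWord bs ++ Γ'.ket :: rest, o, List.replicate v (), []⟩
      ⟨some (.cell false), rest, ((markRow v bs).map some ++ [some Mark.non, none]).reverse ++ o,
        List.replicate (v + 1) (), []⟩ := by
  have hbs : bs = bs.take v ++ bs[v] :: bs.drop (v + 1) := by simp
  have hlen : (bs.take v).length = v := by simp; omega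
  have h1 := markProgram_before (bs.take v) (bitsWord (bs[v] :: bs.drop (v + 1)) ++ Γ'.ket :: rest)
    o [] []
  have h2 : ReachIn (Instr.step markProgram) 3
      ⟨some (.cell false), bitsWord (bs[v] :: bs.drop (v + 1)) ++ Γ'.ket :: rest,
        ((bs.take v).map fun b => some (markOfBool b)).reverse ++ o, [],
        List.replicate (bs.take v).length () ++ []⟩ _ :=
    .head rfl (.head rfl (.head rfl (.refl _)))
  have h3 := markProgram_after (bs.drop (v + 1)) (Γ'.ket :: rest)
    (some .diag :: (((bs.take v).map fun b => some (markOfBool b)).reverse ++ o))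
    (List.replicate v ())
  have h4 : ReachIn (Instr.step markProgram) _ ⟨some (.cell true), Γ'.ket :: rest,
      ((bs.drop (v + 1)).map fun b => some (markOfBool b)).reverse ++
      (some .diag :: (((bs.take v).map fun b => some (markOfBool b)).reverse ++ o)), [],
      List.replicate v ()⟩ _ := .head rfl (markProgram_endRow v rest
      (((bs.drop (v + 1)).map fun b => some (markOfBool b)).reverse ++
      (some .diag :: (((bs.take v).map fun b => some (markOfBool b)).reverse ++ o))))
  rw [hlen] at h1 h2
  simp only [List.append_nil] at h1 h2
  have h := ((h1.trans h2).trans h3).trans h4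
  have hw : bitsWord (bs.take v) ++ (bitsWord (bs[v] :: bs.drop (v + 1)) ++ Γ'.ket :: rest) =
      bitsWord bs ++ Γ'.ket :: rest := by
    conv_rhs => rw [hbs]
    simp only [bitsWord, List.flatMap_append, List.append_assoc]
  rw [hw] at h
  refine h.cast rfl ?_ ?_
  · simp [markRow, Function.comp_def]
  · simp only [List.length_drop]; omega

/-- The marks of the rows, the first of which has its diagonal entry at position `v`. -/
def markRows (v : ℕ) : List (List Bool) → List (List Mark)
  | [] => []
  | bs :: rows => (markRow v bs ++ [.non]) :: markRows (v + 1) rows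

theorem markProgram_rows (n v : ℕ) (rows : List (List Bool)) (hr : ∀ bs ∈ rows, bs.length = n)
    (hv : v + rows.length = n) (o : List (Option Mark)) :
    ReachIn (Instr.step markProgram) (rows.length * (4 * n + 5))
      ⟨some (.cell false), rows.flatMap fun bs => bitsWord bs ++ [Γ'.ket], o,
        List.replicate v (), []⟩
      ⟨some (.cell false), [], (rowsWord (markRows v rows)).reverse ++ o,
        List.replicate n (), []⟩ := by
  induction rows generalizing v o with
  | nil =>
    simp only [List.length_nil, Nat.add_zero] at hv
    subst hv
    exact .refl _
  | cons bs rows ih =>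
    simp only [List.mem_cons, forall_eq_or_imp, List.length_cons] at hr hv
    have h1 := markProgram_row v bs (by omega) (rows.flatMap fun bs => bitsWord bs ++ [Γ'.ket]) o
    have h2 := ih (v + 1) hr.2 (by omega)
      (((markRow v bs).map some ++ [some Mark.non, none]).reverse ++ o)
    have h := h1.trans h2
    refine h.cast ?_ ?_ ?_
    · simp
    · simp [rowsWord, markRows]
    · rw [hr.1, List.length_cons, Nat.add_mul]; omega

theorem markProgram_last (n : ℕ) (b : Bool) (o : List (Option Mark)) :
    ReachIn (Instr.step markProgram) (n + 2)
      ⟨some (.last b), [], o, List.replicate n (), []⟩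
      ⟨none, [], none :: some .diag :: (List.replicate n (some Mark.non) ++
        ((if b then [some Mark.non] else []) ++ o)), [], []⟩ := by
  induction n generalizing b o with
  | zero => exact .head rfl (.head rfl (.refl _))
  | succ n ih =>
    have h : ReachIn (Instr.step markProgram) _
        ⟨some (.last b), [], o, List.replicate (n + 1) (), []⟩ _ :=
      .head rfl (ih true ((if b then [some Mark.non] else []) ++ o))
    refine h.cast rfl ?_ le_rfl
    rw [List.replicate_succ']
    simp

/-- All marks of the graph with an isolated vertex added at the end. -/
def markMatrix (rows : List (List Bool)) : List (List Mark) :=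
  markRows 0 rows ++ [List.replicate rows.length .non ++ [.diag]]

/-- Restoring the counter costs at most about the length of a row, so the total time is linear in
the length of the word, which is quadratic in the number of rows. -/
theorem polyTime_mark {α : Type} (rows : α → List (List Bool))
    (hrows : ∀ a, ∀ bs ∈ rows a, bs.length = (rows a).length) :
    Nonempty (TM2ComputableInPolyTime
      (fun a => (rows a).flatMap fun bs => bitsWord bs ++ [Γ'.ket]) rowsWord
      (fun a => markMatrix (rows a))) := by
  refine polyTime_of_reverse (polyTime_of_machine markProgram (.cell false) 9 fun a => ?_)
  have h1 := markProgram_rows (rows a).length 0 (rows a) (hrows a) (by simp) []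
  have h2 : ReachIn (Instr.step markProgram) _ ⟨some (.cell false), [],
      (rowsWord (markRows 0 (rows a))).reverse ++ [], List.replicate (rows a).length (), []⟩ _ :=
    .head rfl (markProgram_last (rows a).length false
      ((rowsWord (markRows 0 (rows a))).reverse ++ []))
  refine (h1.trans h2).cast rfl ?_ ?_
  · simp [rowsWord, markMatrix]
  · have : ((rows a).flatMap fun bs => bitsWord bs ++ [Γ'.ket]).length =
        (rows a).length * (2 * (rows a).length + 1) := by
      rw [List.length_flatMap, List.map_congr_left (g := fun _ => 2 * (rows a).length + 1)]
      · simp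
      · intro bs hbs
        simp [bitsWord, hrows a bs hbs, Nat.mul_comm]
    rw [this]
    nlinarith

/-! ### Expanding the entries of a matrix into blocks -/

section Expand

variable {M B : Type} {L : ℕ}

/-- The labels of the expanding machine. -/
inductive ExpandLabel (M : Type) (L : ℕ)
  | start
  | read
  | store (m : M)
  | flip
  | flipped (m : M)
  | emit (a : Fin L)
  | put (a : Fin L) (m : M)
  | endRow (a : Fin L)
  | back (a : Fin L)
  | moved (a : Fin L) (m : M)
  | clear
  deriving Fintype

/-- The label at which copy number `i` of a row is written. -/
def ExpandLabel.copy (M : Type) (L i : ℕ) : ExpandLabel M L :=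
  if h : i < L then .emit ⟨i, h⟩ else .clear

/-- The expanding machine writes `header`, and then every row of the input `L` times; in copy `a`,
the entry `m` is replaced by the word `block a m`, and the copy is followed by `eol`. -/
def expandProgram (header : List B) (block : Fin L → M → List B) (eol : B) :
    ExpandLabel M L → Instr (Option M) B M M (ExpandLabel M L)
  | .start => { pushOut := header.reverse, next := fun _ _ _ _ => some .read }
  | .read =>
    { popInp := true
      next := fun a _ _ _ => match a with
        | some (some m) => some (.store m)
        | some none => some .flip
        | none => none }
  | .store m => { pushX := [m], next := fun _ _ _ _ => some .read }
  | .flip =>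
    { popX := true
      next := fun _ _ x _ => match x with
        | some m => some (.flipped m)
        | none => some (.copy M L 0) }
  | .flipped m => { pushY := [m], next := fun _ _ _ _ => some .flip }
  | .emit a =>
    { popY := true
      next := fun _ _ _ y => match y with
        | some m => some (.put a m)
        | none => some (.endRow a) }
  | .put a m =>
    { pushOut := (block a m).reverse, pushX := [m], next := fun _ _ _ _ => some (.emit a) }
  | .endRow a => { pushOut := [eol], next := fun _ _ _ _ => some (.back a) }
  | .back a =>
    { popX := true
      next := fun _ _ x _ => match x with
        | some m => some (.moved a m)
        | none => some (.copy M L (a + 1)) }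
  | .moved a m => { pushY := [m], next := fun _ _ _ _ => some (.back a) }
  | .clear =>
    { popY := true
      next := fun _ _ _ y => match y with
        | some _ => some .clear
        | none => some .read }

variable (header : List B) (block : Fin L → M → List B) (eol : B)

theorem expandProgram_read (r : List M) (w : List (Option M)) (o : List B) (x : List M) :
    ReachIn (Instr.step (expandProgram header block eol)) (2 * r.length + 1)
      ⟨some .read, r.map some ++ none :: w, o, x, []⟩ ⟨some .flip, w, o, r.reverse ++ x, []⟩ := by
  induction r generalizing x with
  | nil => exact .head rfl (.refl _)
  | cons m r ih =>
    have h : ReachIn (Instr.step (expandProgram header block eol)) _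
        ⟨some .read, (m :: r).map some ++ none :: w, o, x, []⟩ _ :=
      .head rfl (.head rfl (ih (m :: x)))
    exact h.cast rfl (by simp) (by simp; omega)

theorem expandProgram_flip (x : List M) (w : List (Option M)) (o : List B) (y : List M) :
    ReachIn (Instr.step (expandProgram header block eol)) (2 * x.length + 1)
      ⟨some .flip, w, o, x, y⟩ ⟨some (.copy M L 0), w, o, [], x.reverse ++ y⟩ := by
  induction x generalizing y with
  | nil => exact .head rfl (.refl _)
  | cons m r ih =>
    have h : ReachIn (Instr.step (expandProgram header block eol)) _
        ⟨some .flip, w, o, m :: r, y⟩ _ := .head rfl (.head rfl (ih (m :: y)))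
    exact h.cast rfl (by simp) (by simp; omega)

theorem expandProgram_emit (a : Fin L) (y : List M) (w : List (Option M)) (o : List B)
    (x : List M) :
    ReachIn (Instr.step (expandProgram header block eol)) (2 * y.length + 2)
      ⟨some (.emit a), w, o, x, y⟩
      ⟨some (.back a), w, (y.flatMap (block a) ++ [eol]).reverse ++ o, y.reverse ++ x, []⟩ := by
  induction y generalizing x o with
  | nil => exact .head rfl (.head rfl (.refl _))
  | cons m r ih =>
    have h : ReachIn (Instr.step (expandProgram header block eol)) _
        ⟨some (.emit a), w, o, x, m :: r⟩ _ :=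
      .head rfl (.head rfl (ih ((block a m).reverse ++ o) (m :: x)))
    exact h.cast rfl (by simp) (by simp; omega)

theorem expandProgram_back (a : Fin L) (x : List M) (w : List (Option M)) (o : List B)
    (y : List M) :
    ReachIn (Instr.step (expandProgram header block eol)) (2 * x.length + 1)
      ⟨some (.back a), w, o, x, y⟩ ⟨some (.copy M L (a + 1)), w, o, [], x.reverse ++ y⟩ := by
  induction x generalizing y with
  | nil => exact .head rfl (.refl _)
  | cons m r ih =>
    have h : ReachIn (Instr.step (expandProgram header block eol)) _
        ⟨some (.back a), w, o, m :: r, y⟩ _ := .head rfl (.head rfl (ih (m :: y)))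
    exact h.cast rfl (by simp) (by simp; omega)

theorem expandProgram_clear (y : List M) (w : List (Option M)) (o : List B) :
    ReachIn (Instr.step (expandProgram header block eol)) (y.length + 1)
      ⟨some .clear, w, o, [], y⟩ ⟨some .read, w, o, [], []⟩ := by
  induction y with
  | nil => exact .head rfl (.refl _)
  | cons m r ih => exact .head rfl ih

/-- The copies with number at least `i` of a row. -/
def expandRow (block : Fin L → M → List B) (eol : B) (i : ℕ) (r : List M) : List B :=
  ((List.finRange L).drop i).flatMap fun a => r.flatMap (block a) ++ [eol]

/-- Induction on the number `j` of copies still to be written. Writing a copy reverses the row onto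
the other stack; moving it back restores the order. -/
theorem expandProgram_copies (r : List M) (w : List (Option M)) (o : List B) (j i : ℕ)
    (hij : i + j = L) :
    ReachIn (Instr.step (expandProgram header block eol)) (j * (4 * r.length + 3) + r.length + 1)
      ⟨some (.copy M L i), w, o, [], r⟩
      ⟨some .read, w, (expandRow block eol i r).reverse ++ o, [], []⟩ := by
  induction j generalizing i o with
  | zero =>
    have h := expandProgram_clear header block eol r w o
    refine h.cast ?_ ?_ (by simp)
    · rw [ExpandLabel.copy, dif_neg (by omega)]
    · rw [expandRow, List.drop_eq_nil_of_le (by simp; omega)]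
      simp
  | succ j ih =>
    have hi : i < L := by omega
    have h1 := expandProgram_emit header block eol ⟨i, hi⟩ r w o []
    have h2 := expandProgram_back header block eol ⟨i, hi⟩ (r.reverse ++ []) w
      ((r.flatMap (block ⟨i, hi⟩) ++ [eol]).reverse ++ o) []
    have h3 := ih ((r.flatMap (block ⟨i, hi⟩) ++ [eol]).reverse ++ o) (i + 1) (by omega)
    simp only [List.append_nil, List.reverse_reverse] at h1 h2
    refine ((h1.trans h2).trans h3).cast ?_ ?_ ?_
    · rw [ExpandLabel.copy, dif_pos hi]
    · have : expandRow block eol i r =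
          (r.flatMap (block ⟨i, hi⟩) ++ [eol]) ++ expandRow block eol (i + 1) r := by
        rw [expandRow, List.drop_eq_getElem_cons (by simpa using hi)]
        simp [expandRow]
      rw [this]
      simp
    · simp only [List.length_reverse]
      rw [Nat.add_mul]
      omega

/-- Each symbol is moved a number of times that depends on `L` alone, so the time is linear. -/
theorem expandProgram_rows (rows : List (List M)) (o : List B) :
    ReachIn (Instr.step (expandProgram header block eol))
      ((4 * L + 9) * ((rowsWord rows).length + 1))
      ⟨some .read, rowsWord rows, o, [], []⟩
      ⟨none, [], (rows.flatMap (expandRow block eol 0)).reverse ++ o, [], []⟩ := by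
  induction rows generalizing o with
  | nil =>
    have h : ReachIn (Instr.step (expandProgram header block eol)) 1
      ⟨some .read, [], o, [], []⟩ _ := .head rfl (.refl _)
    exact h.cast rfl rfl (by simp [rowsWord])
  | cons r rows ih =>
    have h1 := expandProgram_read header block eol r (rowsWord rows) o []
    have h2 := expandProgram_flip header block eol (r.reverse ++ []) (rowsWord rows) o []
    have h3 := expandProgram_copies header block eol r (rowsWord rows) o L 0 (by simp)
    have h4 := ih ((expandRow block eol 0 r).reverse ++ o)
    simp only [List.append_nil, List.reverse_reverse] at h1 h2
    refine (((h1.trans h2).trans h3).trans h4).cast ?_ ?_ ?_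
    · simp [rowsWord]
    · simp
    · have : (rowsWord (r :: rows)).length = r.length + 1 + (rowsWord rows).length := by
        simp [rowsWord]; omega
      rw [this, List.length_reverse]
      nlinarith

theorem polyTime_expand [Finite M] [Finite B] [Inhabited B] :
    Nonempty (TM2ComputableInPolyTime (rowsWord (M := M)) id
      (fun rows => header ++ rows.flatMap (expandRow block eol 0))) := by
  have : Fintype M := Fintype.ofFinite M
  refine polyTime_of_reverse (polyTime_of_machine (expandProgram header block eol) .start
    (4 * L + 10) fun rows => ?_)
  have h : ReachIn (Instr.step (expandProgram header block eol)) _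
      ⟨some .start, rowsWord rows, [], [], []⟩ _ :=
    .head rfl (expandProgram_rows header block eol rows (header.reverse ++ []))
  refine h.cast rfl (by simp) ?_
  nlinarith

end Expand

/-! ### Rounding the entries of a rational matrix -/

section Round

variable {S Q : Type}

/-- A finite automaton reads the binary digits of two numbers in parallel; the shorter word is
padded with zeros. -/
def runDigits (upd : S → Bool → Bool → S) : S → List Bool → List Bool → S
  | st, [], [] => st
  | st, p :: ps, [] => runDigits upd (upd st p false) ps []
  | st, [], q :: qs => runDigits upd (upd st false q) [] qs
  | st, p :: ps, q :: qs => runDigits upd (upd st p q) ps qs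

/-- The labels of the rounding machine. -/
inductive RoundLabel (S : Type)
  | cell
  | endRow
  | num (s : Bool)
  | store (s b : Bool)
  | flip (s : Bool)
  | flipped (s b : Bool)
  | cmp (s : Bool) (st : S)
  | drain (s : Bool) (st : S)
  | emit (s : Bool) (st : S)
  deriving Fintype

/-- The rounding machine: every rational entry is replaced by one symbol, which depends on its sign
and on the final state of an automaton that reads numerator and denominator. -/
def roundProgram (st₀ : S) (upd : S → Bool → Bool → S) (sym : Bool → S → Q) :
    RoundLabel S → Instr Γ' (Option Q) Bool Bool (RoundLabel S)
  | .cell =>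
    { popInp := true
      next := fun a _ _ _ => match a with
        | some (Γ'.bit s) => some (.num s)
        | some Γ'.ket => some .endRow
        | _ => none }
  | .endRow => { pushOut := [none], next := fun _ _ _ _ => some .cell }
  | .num s =>
    { popInp := true
      next := fun a _ _ _ => match a with
        | some (Γ'.bit b) => some (.store s b)
        | _ => some (.flip s) }
  | .store s b => { pushX := [b], next := fun _ _ _ _ => some (.num s) }
  | .flip s =>
    { popX := true
      next := fun _ _ x _ => match x with
        | some b => some (.flipped s b)
        | none => some (.cmp s st₀) }
  | .flipped s b => { pushY := [b], next := fun _ _ _ _ => some (.flip s) }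
  | .cmp s st =>
    { popInp := true
      popY := true
      next := fun a _ _ y => match a, y with
        | some (Γ'.bit q), some p => some (.cmp s (upd st p q))
        | some (Γ'.bit q), none => some (.cmp s (upd st false q))
        | _, some p => some (.drain s (upd st p false))
        | _, none => some (.emit s st) }
  | .drain s st =>
    { popY := true
      next := fun _ _ _ y => match y with
        | some p => some (.drain s (upd st p false))
        | none => some (.emit s st) }
  | .emit s st => { pushOut := [some (sym s st)], next := fun _ _ _ _ => some .cell }

variable (st₀ : S) (upd : S → Bool → Bool → S) (sym : Bool → S → Q)

theorem roundProgram_num (s : Bool) (ps : List Bool) (w : List Γ') (o : List (Option Q))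
    (x : List Bool) :
    ReachIn (Instr.step (roundProgram st₀ upd sym)) (2 * ps.length + 1)
      ⟨some (.num s), ps.map Γ'.bit ++ Γ'.bra :: w, o, x, []⟩
      ⟨some (.flip s), w, o, ps.reverse ++ x, []⟩ := by
  induction ps generalizing x with
  | nil => exact .head rfl (.refl _)
  | cons p ps ih =>
    have h : ReachIn (Instr.step (roundProgram st₀ upd sym)) _
        ⟨some (.num s), (p :: ps).map Γ'.bit ++ Γ'.bra :: w, o, x, []⟩ _ :=
      .head rfl (.head rfl (ih (p :: x)))
    exact h.cast rfl (by simp) (by simp; omega)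

theorem roundProgram_flip (s : Bool) (x : List Bool) (w : List Γ') (o : List (Option Q))
    (y : List Bool) :
    ReachIn (Instr.step (roundProgram st₀ upd sym)) (2 * x.length + 1)
      ⟨some (.flip s), w, o, x, y⟩ ⟨some (.cmp s st₀), w, o, [], x.reverse ++ y⟩ := by
  induction x generalizing y with
  | nil => exact .head rfl (.refl _)
  | cons m r ih =>
    have h : ReachIn (Instr.step (roundProgram st₀ upd sym)) _
        ⟨some (.flip s), w, o, m :: r, y⟩ _ := .head rfl (.head rfl (ih (m :: y)))
    exact h.cast rfl (by simp) (by simp; omega)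

theorem roundProgram_drain (s : Bool) (st : S) (ps : List Bool) (w : List Γ')
    (o : List (Option Q)) :
    ReachIn (Instr.step (roundProgram st₀ upd sym)) (ps.length + 1)
      ⟨some (.drain s st), w, o, [], ps⟩
      ⟨some (.emit s (runDigits upd st ps [])), w, o, [], []⟩ := by
  induction ps generalizing st with
  | nil => exact .head rfl ((ReachIn.refl _).cast rfl (by rw [runDigits]; rfl) le_rfl)
  | cons p ps ih =>
    have h : ReachIn (Instr.step (roundProgram st₀ upd sym)) _
        ⟨some (.drain s st), w, o, [], p :: ps⟩ _ := .head rfl (ih (upd st p false))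
    exact h.cast rfl (by rw [runDigits.eq_2]) (by simp)

/-- Binary words start with the lowest digit. The numerator was turned over twice, so its lowest
digit is on top of the stack when that of the denominator is next on the input, and the automaton
reads both in parallel. -/
theorem roundProgram_cmp (s : Bool) (st : S) (ps qs : List Bool) (w : List Γ')
    (o : List (Option Q)) :
    ReachIn (Instr.step (roundProgram st₀ upd sym)) (ps.length + qs.length + 1)
      ⟨some (.cmp s st), qs.map Γ'.bit ++ Γ'.comma :: w, o, [], ps⟩
      ⟨some (.emit s (runDigits upd st ps qs)), w, o, [], []⟩ := by
  induction qs generalizing st ps with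
  | nil =>
    cases ps with
    | nil => exact .head rfl ((ReachIn.refl _).cast rfl (by rw [runDigits]; rfl) le_rfl)
    | cons p ps =>
      have h : ReachIn (Instr.step (roundProgram st₀ upd sym)) _
          ⟨some (.cmp s st), Γ'.comma :: w, o, [], p :: ps⟩ _ :=
        .head rfl (roundProgram_drain st₀ upd sym s (upd st p false) ps w o)
      exact h.cast rfl (by rw [runDigits.eq_2]) (by simp)
  | cons q qs ih =>
    cases ps with
    | nil =>
      have h : ReachIn (Instr.step (roundProgram st₀ upd sym)) _
          ⟨some (.cmp s st), (q :: qs).map Γ'.bit ++ Γ'.comma :: w, o, [], []⟩ _ :=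
        .head rfl (ih (upd st false q) [])
      exact h.cast rfl (by rw [runDigits.eq_3]) (by simp)
    | cons p ps =>
      have h : ReachIn (Instr.step (roundProgram st₀ upd sym)) _
          ⟨some (.cmp s st), (q :: qs).map Γ'.bit ++ Γ'.comma :: w, o, [], p :: ps⟩ _ :=
        .head rfl (ih (upd st p q) ps)
      exact h.cast rfl (by rw [runDigits.eq_4]) (by simp; omega)

/-- The symbol that replaces a rational number. -/
def roundRat (q : ℚ) : Q :=
  sym (decide (q < 0)) (runDigits upd st₀ (encodeNat q.num.natAbs) (encodeNat q.den))

theorem roundProgram_entry (q : ℚ) (w : List Γ') (o : List (Option Q)) :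
    ReachIn (Instr.step (roundProgram st₀ upd sym)) (6 * (encodeRat q).length)
      ⟨some .cell, encodeRat q ++ Γ'.comma :: w, o, [], []⟩
      ⟨some .cell, w, some (roundRat st₀ upd sym q) :: o, [], []⟩ := by
  set ps := encodeNat q.num.natAbs
  set qs := encodeNat q.den
  set s := decide (q < 0)
  have hq : encodeRat q = Γ'.bit s :: (ps.map Γ'.bit ++ Γ'.bra :: qs.map Γ'.bit) := rfl
  have h1 : ReachIn (Instr.step (roundProgram st₀ upd sym)) _
      ⟨some .cell, Γ'.bit s :: (ps.map Γ'.bit ++ Γ'.bra :: (qs.map Γ'.bit ++ Γ'.comma :: w)),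
        o, [], []⟩ _ :=
    .head rfl (roundProgram_num st₀ upd sym s ps (qs.map Γ'.bit ++ Γ'.comma :: w) o [])
  have h2 := roundProgram_flip st₀ upd sym s (ps.reverse ++ []) (qs.map Γ'.bit ++ Γ'.comma :: w)
    o []
  have h3 := roundProgram_cmp st₀ upd sym s st₀ ps qs w o
  have h4 : ReachIn (Instr.step (roundProgram st₀ upd sym)) 1
      ⟨some (.emit s (runDigits upd st₀ ps qs)), w, o, [], []⟩
      ⟨some .cell, w, some (roundRat st₀ upd sym q) :: o, [], []⟩ := .head rfl (.refl _)
  simp only [List.append_nil, List.reverse_reverse] at h1 h2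
  refine (((h1.trans h2).trans h3).trans h4).cast ?_ rfl ?_
  · rw [hq]; simp
  · rw [hq]; simp; omega

theorem roundProgram_row (r : List ℚ) (w : List Γ') (o : List (Option Q)) :
    ReachIn (Instr.step (roundProgram st₀ upd sym))
      (6 * (terminated Γ'.comma (r.map encodeRat)).length + 2)
      ⟨some .cell, terminated Γ'.comma (r.map encodeRat) ++ Γ'.ket :: w, o, [], []⟩
      ⟨some .cell, w, ((r.map (roundRat st₀ upd sym)).map some ++ [none]).reverse ++ o,
        [], []⟩ := by
  induction r generalizing o with
  | nil => exact .head rfl (.head rfl (.refl _))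
  | cons q r ih =>
    have h1 := roundProgram_entry st₀ upd sym q
      (terminated Γ'.comma (r.map encodeRat) ++ Γ'.ket :: w) o
    refine (h1.trans (ih (some (roundRat st₀ upd sym q) :: o))).cast ?_ ?_ ?_
    · simp [terminated]
    · simp
    · simp [terminated]; omega

theorem roundProgram_rows (rows : List (List ℚ)) (o : List (Option Q)) :
    ReachIn (Instr.step (roundProgram st₀ upd sym))
      (6 * ((terminated Γ'.ket (rows.map fun r => terminated Γ'.comma (r.map encodeRat))).length
        + 1))
      ⟨some .cell, terminated Γ'.ket (rows.map fun r => terminated Γ'.comma (r.map encodeRat)), o,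
        [], []⟩
      ⟨none, [], (rowsWord (rows.map fun r => r.map (roundRat st₀ upd sym))).reverse ++ o,
        [], []⟩ := by
  induction rows generalizing o with
  | nil =>
    have h : ReachIn (Instr.step (roundProgram st₀ upd sym)) 1
      ⟨some .cell, [], o, [], []⟩ _ := .head rfl (.refl _)
    exact h.cast rfl rfl (by omega)
  | cons r rows ih =>
    have h1 := roundProgram_row st₀ upd sym r
      (terminated Γ'.ket (rows.map fun r => terminated Γ'.comma (r.map encodeRat))) o
    refine (h1.trans (ih
      (((r.map (roundRat st₀ upd sym)).map some ++ [none]).reverse ++ o))).cast ?_ ?_ ?_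
    · simp [terminated]
    · simp [rowsWord]
    · have : (terminated Γ'.ket ((r :: rows).map fun r =>
          terminated Γ'.comma (r.map encodeRat))).length =
          (terminated Γ'.comma (r.map encodeRat)).length + 1 +
          (terminated Γ'.ket (rows.map fun r => terminated Γ'.comma (r.map encodeRat))).length := by
        rw [terminated, List.map_cons, List.flatMap_cons, List.length_append, List.length_append]
        rfl
      rw [this]
      omega

theorem polyTime_round [Finite S] [Finite Q] :
    Nonempty (TM2ComputableInPolyTime
      (fun rows : List (List ℚ) =>
        terminated Γ'.ket (rows.map fun r => terminated Γ'.comma (r.map encodeRat)))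
      rowsWord (fun rows => rows.map fun r => r.map (roundRat st₀ upd sym))) := by
  have : Fintype S := Fintype.ofFinite S
  refine polyTime_of_reverse (polyTime_of_machine (roundProgram st₀ upd sym) .cell 6
    fun rows => ?_)
  exact (roundProgram_rows st₀ upd sym rows []).cast rfl (by simp) le_rfl

end Round

/-! ### The greedy net -/

section Net

variable {Q : Type} {c L : ℕ}

/-- The entries of the centers in one column; `none` if the center is not yet chosen. -/
abbrev Column (Q : Type) (c : ℕ) : Type := Fin c → Option Q

/-- Whether an entry is compatible with the entry of a center in the same column. -/
def compatible (close : Q → Q → Bool) (s : Q) (v : Option Q) : Bool := v.elim true (close s)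

open Classical in
/-- The first index with a true flag. -/
noncomputable def firstTrue [NeZero c] (flags : Fin c → Bool) : Fin c :=
  if h : {j | flags j = true}.Nonempty then wellFounded_lt.min _ h else 0

/-- If the center number `j` is not yet chosen, it is defined. -/
def fillColumn (j : Fin c) (p : Q × Column Q c) : Column Q c :=
  Function.update p.2 j ((p.2 j).or (some p.1))

/-- A row together with the columns of the centers, none of which need be chosen yet. -/
def zipColumns : List Q → List (Column Q c) → List (Q × Column Q c)
  | [], _ => []
  | s :: r, [] => (s, fun _ => none) :: zipColumns r []
  | s :: r, v :: vs => (s, v) :: zipColumns r vs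

theorem length_zipColumns (r : List Q) (V : List (Column Q c)) :
    (zipColumns r V).length = r.length := by
  induction r generalizing V with
  | nil => rfl
  | cons s r ih => cases V <;> simp [zipColumns, ih]

/-- The number of the first center that is not chosen or close to the row `r`. -/
noncomputable def netColor [NeZero c] (close : Q → Q → Bool) (r : List Q)
    (V : List (Column Q c)) : Fin c :=
  firstTrue fun j => (zipColumns r V).all fun p => compatible close p.1 (p.2 j)

/-- The centers after the row `r` is treated. -/
noncomputable def netColumns [NeZero c] (close : Q → Q → Bool) (r : List Q)
    (V : List (Column Q c)) : List (Column Q c) :=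
  (zipColumns r V).map (fillColumn (netColor close r V))

/-- The colors of the rows. -/
noncomputable def netColors [NeZero c] (close : Q → Q → Bool) :
    List (List Q) → List (Column Q c) → List (Fin c)
  | [], _ => []
  | r :: rows, V => netColor close r V :: netColors close rows (netColumns close r V)

/-- The elements of a list whose positions, counted from `i`, are divisible by `L`. -/
def sample [NeZero L] {α : Type} : Fin L → List α → List α
  | _, [] => []
  | i, a :: w => (if i = 0 then [a] else []) ++ sample (i + 1) w

/-- The labels of the net machine. -/
inductive NetLabel (Q : Type) (c L : ℕ)
  | forth (i : Fin L) (flags : Fin c → Bool) (p : Option (Q × (Fin c → Option Q)))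
  | back (i : Fin L) (j : Fin c) (v : Option (Fin c → Option Q))
  | emit (i : Fin L) (j : Fin c)
  | clear (first : Bool)
  deriving Fintype

/-- The net machine. The first working stack holds the columns of the centers. -/
noncomputable def netProgram [NeZero c] [NeZero L] (close : Q → Q → Bool) :
    NetLabel Q c L → Instr (Option Q) (Fin c) (Column Q c) (Q × Column Q c) (NetLabel Q c L)
  | .forth i flags p =>
    { pushY := p.toList
      popInp := true
      popX := true
      next := fun a _ x _ => match a, x with
        | some (some s), some v =>
          some (.forth i (fun j => flags j && compatible close s (v j)) (some (s, v)))
        -- During the first row the stack of columns is empty, as the width is not yet known;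
        -- columns without centers are created on the way.
        | some (some s), none => some (.forth i flags (some (s, fun _ => none)))
        | some none, _ => some (.back i (firstTrue flags) none)
        | none, _ => some (.clear true) }
  | .back i j v =>
    { pushX := v.toList
      popY := true
      next := fun _ _ _ y => match y with
        | some p => some (.back i j (some (fillColumn j p)))
        | none => some (.emit i j) }
  | .emit i j =>
    { pushOut := if i = 0 then [j] else []
      next := fun _ _ _ _ => some (.forth (i + 1) (fun _ => true) none) }
  | .clear first =>
    -- The color written last, which will be that of the added isolated vertex, is discarded; this
    -- is the `dropLast` in `polyTime_net`.
    { popOut := first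
      popX := true
      next := fun _ _ x _ => match x with
        | some _ => some (.clear false)
        | none => none }

variable [NeZero c] [NeZero L] (close : Q → Q → Bool)

/-- All `c` centers are tested in one pass: their flags are part of the label, which ranges over a
finite set because `c` is fixed. -/
theorem netProgram_forth (i : Fin L) (flags : Fin c → Bool) (p : Option (Q × Column Q c))
    (r : List Q) (V : List (Column Q c)) (hV : V = [] ∨ V.length = r.length)
    (w : List (Option Q)) (o : List (Fin c)) (y : List (Q × Column Q c)) :
    ReachIn (Instr.step (netProgram (L := L) close)) (r.length + 1)
      ⟨some (.forth i flags p), r.map some ++ none :: w, o, V, y⟩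
      ⟨some (.back i (firstTrue fun j => flags j &&
        (zipColumns r V).all fun p => compatible close p.1 (p.2 j)) none), w, o, [],
        (zipColumns r V).reverse ++ (p.toList ++ y)⟩ := by
  induction r generalizing flags p V y with
  | nil =>
    have hV : V = [] := by simpa using hV
    subst hV
    have h : ReachIn (Instr.step (netProgram (L := L) close)) 1
        ⟨some (.forth i flags p), none :: w, o, [], y⟩
        ⟨some (.back i (firstTrue flags) none), w, o, [], p.toList ++ y⟩ := .head rfl (.refl _)
    exact h.cast rfl (by simp [zipColumns]) le_rfl
  | cons s r ih =>
    cases V with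
    | nil =>
      have h : ReachIn (Instr.step (netProgram (L := L) close)) _
          ⟨some (.forth i flags p), (s :: r).map some ++ none :: w, o, [], y⟩ _ :=
        .head rfl (ih flags (some (s, fun _ => none)) [] (Or.inl rfl) (p.toList ++ y))
      exact h.cast rfl (by simp [zipColumns, compatible]) le_rfl
    | cons v V =>
      have h : ReachIn (Instr.step (netProgram (L := L) close)) _
          ⟨some (.forth i flags p), (s :: r).map some ++ none :: w, o, v :: V, y⟩ _ :=
        .head rfl (ih (fun j => flags j && compatible close s (v j)) (some (s, v)) V
          (Or.inr (by simpa using hV)) (p.toList ++ y))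
      exact h.cast rfl (by simp [zipColumns, Bool.and_assoc]) le_rfl

theorem netProgram_back (i : Fin L) (j : Fin c) (v : Option (Column Q c))
    (w : List (Option Q)) (o : List (Fin c)) (x : List (Column Q c)) (y : List (Q × Column Q c)) :
    ReachIn (Instr.step (netProgram (L := L) close)) (y.length + 1)
      ⟨some (.back i j v), w, o, x, y⟩
      ⟨some (.emit i j), w, o, (y.map (fillColumn j)).reverse ++ (v.toList ++ x), []⟩ := by
  induction y generalizing v x with
  | nil => exact .head rfl (.refl _)
  | cons p y ih =>
    have h : ReachIn (Instr.step (netProgram (L := L) close)) _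
        ⟨some (.back i j v), w, o, x, p :: y⟩ _ :=
      .head rfl (ih (some (fillColumn j p)) (v.toList ++ x))
    exact h.cast rfl (by simp) le_rfl

theorem netProgram_clear (V : List (Column Q c)) (o : List (Fin c)) :
    ReachIn (Instr.step (netProgram (L := L) close)) (V.length + 1)
      ⟨some (.clear false), [], o, V, []⟩ ⟨none, [], o, [], []⟩ := by
  induction V with
  | nil => exact .head rfl (.refl _)
  | cons v V ih => exact .head rfl ih

theorem netProgram_clear_true (V : List (Column Q c)) (o : List (Fin c)) :
    ReachIn (Instr.step (netProgram (L := L) close)) (V.length + 1)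
      ⟨some (.clear true), [], o, V, []⟩ ⟨none, [], o.tail, [], []⟩ := by
  cases V with
  | nil => exact .head rfl (.refl _)
  | cons v V => exact .head rfl (netProgram_clear close V o.tail)

theorem netProgram_rows (N : ℕ) (rows : List (List Q)) (hr : ∀ r ∈ rows, r.length = N)
    (i : Fin L) (V : List (Column Q c)) (hV : V = [] ∨ V.length = N) (o : List (Fin c)) :
    ReachIn (Instr.step (netProgram (L := L) close)) (3 * (rowsWord rows).length + N + 2)
      ⟨some (.forth i (fun _ => true) none), rowsWord rows, o, V, []⟩
      ⟨none, [], ((sample i (netColors close rows V)).reverse ++ o).tail, [], []⟩ := by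
  induction rows generalizing i V o with
  | nil =>
    have h : ReachIn (Instr.step (netProgram (L := L) close)) _
        ⟨some (.forth i (fun _ => true) none), [], o, V, []⟩ _ :=
      .head rfl (netProgram_clear_true close V.tail o)
    refine h.cast rfl rfl ?_
    have : V.tail.length ≤ N := by rcases hV with rfl | h <;> simp; omega
    omega
  | cons r rows ih =>
    simp only [List.mem_cons, forall_eq_or_imp] at hr
    have h1 := netProgram_forth (L := L) close i (fun _ => true) none r V (by rwa [hr.1])
      (rowsWord rows) o []
    have h2 := netProgram_back (L := L) close i (netColor close r V) none (rowsWord rows) o []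
      (zipColumns r V).reverse
    have h3 : ReachIn (Instr.step (netProgram (L := L) close)) 1
        ⟨some (.emit i (netColor close r V)), rowsWord rows, o, netColumns close r V, []⟩
        ⟨some (.forth (i + 1) (fun _ => true) none), rowsWord rows,
          (if i = 0 then [netColor close r V] else []) ++ o, netColumns close r V, []⟩ :=
      .head rfl (.refl _)
    have h4 := ih hr.2 (i + 1) (netColumns close r V)
      (Or.inr (by simp [netColumns, length_zipColumns, hr.1]))
      ((if i = 0 then [netColor close r V] else []) ++ o)
    have h12 := (h1.cast rfl (by simp [netColor]) le_rfl).trans h2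
    have h123 := (h12.cast rfl (by simp [netColumns, List.map_reverse]) le_rfl).trans h3
    refine (h123.trans h4).cast ?_ ?_ ?_
    · simp [rowsWord]
    · rw [netColors, sample]
      split_ifs <;> simp
    · have : (rowsWord (r :: rows)).length = N + 1 + (rowsWord rows).length := by
        simp [rowsWord, hr.1]; omega
      simp only [List.length_reverse, length_zipColumns, hr.1, this]
      omega

theorem polyTime_net [Finite Q] {α : Type} (rows : α → List (List Q))
    (hr : ∀ a, ∀ r ∈ rows a, r.length = (rows a).length) :
    Nonempty (TM2ComputableInPolyTime (fun a => rowsWord (rows a)) id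
      (fun a => (sample (0 : Fin L) (netColors (c := c) close (rows a) [])).dropLast)) := by
  have : Fintype Q := Fintype.ofFinite Q
  refine polyTime_of_reverse (polyTime_of_machine (netProgram (L := L) close)
    (.forth 0 (fun _ => true) none) 4 fun a => ?_)
  refine (netProgram_rows close (rows a).length (rows a) (hr a) 0 [] (Or.inl rfl) []).cast rfl
    ?_ ?_
  · simp
  · have : (rows a).length ≤ (rowsWord (rows a)).length := by
      rw [rowsWord, List.length_flatMap]
      calc (rows a).length = ((rows a).map fun _ => 1).sum := by simp
        _ ≤ _ := List.sum_le_sum fun r _ => by simp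
    omega

end Net

/-! ### Correctness of the greedy net -/

section NetCorrect

variable {Q ι : Type} {c N : ℕ}

theorem firstTrue_spec [NeZero c] {flags : Fin c → Bool} (h : ∃ j, flags j = true) :
    flags (firstTrue flags) = true ∧ ∀ j < firstTrue flags, flags j = false := by
  have h' : {j | flags j = true}.Nonempty := h
  rw [firstTrue, dif_pos h']
  refine ⟨wellFounded_lt.min_mem _ h', fun j hj => ?_⟩
  by_contra hc
  exact wellFounded_lt.not_lt_min {j | flags j = true} (by simpa using hc) hj

/-- Whether two rows are close in every column. -/
def RowsClose (close : Q → Q → Bool) (R : ι → Fin N → Q) (a b : ι) : Prop :=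
  ∀ w, close (R a w) (R b w) = true

open Classical in
/-- Whether the row `a` may belong to the center number `j`. -/
noncomputable def centerFlags (close : Q → Q → Bool) (R : ι → Fin N → Q) (a : ι)
    (cen : Fin c → Option ι) (j : Fin c) : Bool :=
  (cen j).elim true fun b => decide (RowsClose close R a b)

/-- The centers after the row `a` is treated. -/
noncomputable def nextCenters [NeZero c] (close : Q → Q → Bool) (R : ι → Fin N → Q) (a : ι)
    (cen : Fin c → Option ι) : Fin c → Option ι :=
  Function.update cen (firstTrue (centerFlags close R a cen))
    ((cen (firstTrue (centerFlags close R a cen))).or (some a))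

/-- The centers after some rows are treated. -/
noncomputable def finalCenters [NeZero c] (close : Q → Q → Bool) (R : ι → Fin N → Q) :
    List ι → (Fin c → Option ι) → Fin c → Option ι
  | [], cen => cen
  | a :: l, cen => finalCenters close R l (nextCenters close R a cen)

/-- The colors of some rows. -/
noncomputable def centerColors [NeZero c] (close : Q → Q → Bool) (R : ι → Fin N → Q) :
    List ι → (Fin c → Option ι) → List (Fin c)
  | [], _ => []
  | a :: l, cen => firstTrue (centerFlags close R a cen) ::
      centerColors close R l (nextCenters close R a cen)

theorem length_centerColors [NeZero c] (close : Q → Q → Bool) (R : ι → Fin N → Q) (l : List ι)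
    (cen : Fin c → Option ι) : (centerColors close R l cen).length = l.length := by
  induction l generalizing cen with
  | nil => rfl
  | cons a l ih => simp [centerColors, ih]

/-- The columns of a family of centers. -/
def centerColumns (R : ι → Fin N → Q) (cen : Fin c → Option ι) : List (Column Q c) :=
  List.ofFn fun w j => (cen j).map (R · w)

theorem zipColumns_nil (r : List Q) :
    zipColumns r ([] : List (Column Q c)) = r.map fun s => (s, fun _ => none) := by
  induction r with
  | nil => rfl
  | cons s r ih => simp [zipColumns, ih]

theorem zipColumns_ofFn {n : ℕ} (s : Fin n → Q) (v : Fin n → Column Q c) :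
    zipColumns (List.ofFn s) (List.ofFn v) = List.ofFn fun w => (s w, v w) := by
  induction n with
  | zero => rfl
  | succ n ih => simp [List.ofFn_succ, zipColumns, ih]

/-- Replaces the stored columns by centers that are indices of rows, on which the combinatorial
argument runs. The empty list is the state before the first row. -/
theorem netColors_eq_centerColors [NeZero c] (close : Q → Q → Bool) (R : ι → Fin N → Q)
    (l : List ι) (cen : Fin c → Option ι) (V : List (Column Q c))
    (hV : V = centerColumns R cen ∨ V = [] ∧ cen = fun _ => none) :
    netColors close (l.map fun a => List.ofFn (R a)) V = centerColors close R l cen := by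
  induction l generalizing cen V with
  | nil => rfl
  | cons a l ih =>
    have hz : zipColumns (List.ofFn (R a)) V =
        List.ofFn fun w => (R a w, fun j => (cen j).map (R · w)) := by
      rcases hV with rfl | ⟨rfl, rfl⟩
      · exact zipColumns_ofFn _ _
      · rw [zipColumns_nil, List.map_ofFn]
        rfl
    have hc : netColor close (List.ofFn (R a)) V = firstTrue (centerFlags close R a cen) := by
      rw [netColor, hz]
      congr 1
      funext j
      rw [Bool.eq_iff_iff]
      cases hj : cen j
      · simp [List.all_eq_true, List.mem_ofFn, compatible, centerFlags, hj]
      · simp only [List.all_eq_true, List.mem_ofFn, centerFlags, hj, Option.elim_some,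
          decide_eq_true_eq]
        simp [compatible, hj, RowsClose]
    simp only [List.map_cons, netColors, centerColors, hc]
    congr 1
    refine ih _ _ (Or.inl ?_)
    rw [netColumns, hz, hc, List.map_ofFn, centerColumns]
    congr 1
    funext w j
    simp only [Function.comp_apply, fillColumn, nextCenters]
    by_cases h : j = firstTrue (centerFlags close R a cen)
    · subst h
      cases h' : cen (firstTrue (centerFlags close R a cen)) <;> simp
    · simp [Function.update_of_ne h]

/-- The centers are chosen in order, and no two of them are close. -/
structure CentersValid (close : Q → Q → Bool) (R : ι → Fin N → Q) (cen : Fin c → Option ι) :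
    Prop where
  mono : ∀ i j, i ≤ j → (cen j).isSome → (cen i).isSome
  far : ∀ i j a b, i ≠ j → cen i = some a → cen j = some b → ¬ RowsClose close R a b

variable {close : Q → Q → Bool} {R : ι → Fin N → Q}

/-- If no center accepted `a`, all `c` centers would be chosen, pairwise far and far from `a`:
together `c + 1` separated rows, against `hpack`. Hence the default value of `firstTrue` never
occurs. -/
theorem CentersValid.exists_flag (hrefl : ∀ a, RowsClose close R a a)
    (hsymm : ∀ a b, RowsClose close R a b → RowsClose close R b a)
    (hpack : ∀ s : Finset ι, (s : Set ι).Pairwise (fun a b => ¬ RowsClose close R a b) →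
      s.card ≤ c) {cen : Fin c → Option ι} (hcen : CentersValid close R cen) (a : ι) :
    ∃ j, centerFlags close R a cen j = true := by
  classical
  by_contra hno
  push Not at hno
  have h : ∀ j, ∃ b, cen j = some b ∧ ¬ RowsClose close R a b := by
    intro j
    have := hno j
    cases hj : cen j with
    | none => simp [centerFlags, hj] at this
    | some b => exact ⟨b, rfl, by simpa [centerFlags, hj] using this⟩
  choose g hg hga using h
  have hinj : Function.Injective g := by
    intro i j hij
    by_contra hne
    exact hcen.far i j _ _ hne (hg i) (hg j) (hij ▸ hrefl _)
  have ha : a ∉ Finset.univ.image g := by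
    simp only [Finset.mem_image, Finset.mem_univ, true_and, not_exists]
    intro j hj
    exact hga j (hj ▸ hrefl _)
  have := hpack (insert a (Finset.univ.image g)) (by
    intro x hx y hy hxy
    simp only [Finset.coe_insert, Finset.coe_image, Finset.coe_univ, Set.image_univ,
      Set.mem_insert_iff, Set.mem_range] at hx hy
    rcases hx with rfl | ⟨i, rfl⟩ <;> rcases hy with rfl | ⟨j, rfl⟩
    · exact absurd rfl hxy
    · exact hga j
    · exact fun h => hga i (hsymm _ _ h)
    · exact hcen.far i j _ _ (fun h => hxy (by rw [h])) (hg i) (hg j))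
  rw [Finset.card_insert_of_notMem ha, Finset.card_image_of_injective _ hinj] at this
  simp at this

variable [NeZero c]

/-- An unchosen center accepts every row. So if the first accepting index is unchosen, all smaller
indices are chosen and far from `a`, while all larger ones are unchosen by monotonicity; `a` may
become a center there. -/
theorem CentersValid.next (hsymm : ∀ a b, RowsClose close R a b → RowsClose close R b a)
    {cen : Fin c → Option ι} (hcen : CentersValid close R cen) {a : ι}
    (h : ∃ j, centerFlags close R a cen j = true) :
    CentersValid close R (nextCenters close R a cen) := by
  obtain ⟨-, h2⟩ := firstTrue_spec h
  set j₀ := firstTrue (centerFlags close R a cen) with hj₀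
  cases hc : cen j₀ with
  | some b =>
    have : nextCenters close R a cen = cen := by
      rw [nextCenters, ← hj₀, hc]
      exact Function.update_eq_self_iff.2 hc.symm
    rw [this]
    exact hcen
  | none =>
    have hn : nextCenters close R a cen = Function.update cen j₀ (some a) := by
      rw [nextCenters, ← hj₀, hc]
      simp
    have hlt : ∀ j b, cen j = some b → j < j₀ := by
      intro j b hj
      by_contra hle
      have := hcen.mono j₀ j (not_lt.1 hle) (by simp [hj])
      simp [hc] at this
    have hfar : ∀ j b, cen j = some b → ¬ RowsClose close R a b := by
      intro j b hj
      have := h2 j (hlt j b hj)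
      simpa [centerFlags, hj] using this
    rw [hn]
    constructor
    · intro i j hij hj
      by_cases hi : i = j₀
      · simp [hi]
      rw [Function.update_of_ne hi]
      by_cases hj' : j = j₀
      · have hi' : i < j₀ := lt_of_le_of_ne (hj' ▸ hij) hi
        have := h2 i hi'
        cases hci : cen i with
        | none => simp [centerFlags, hci] at this
        | some b => rfl
      · rw [Function.update_of_ne hj'] at hj
        exact hcen.mono i j hij hj
    · intro i j x y hij hx hy
      by_cases hi : i = j₀
      · subst hi
        rw [Function.update_self] at hx
        rw [Function.update_of_ne hij.symm] at hy
        obtain rfl := Option.some.inj hx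
        exact hfar j y hy
      · rw [Function.update_of_ne hi] at hx
        by_cases hj : j = j₀
        · subst hj
          rw [Function.update_self] at hy
          obtain rfl := Option.some.inj hy
          exact fun h => hfar i x hx (hsymm _ _ h)
        · rw [Function.update_of_ne hj] at hy
          exact hcen.far i j x y hij hx hy

theorem nextCenters_eq_of_some {cen : Fin c → Option ι} {j : Fin c} {b : ι} (h : cen j = some b)
    (a : ι) : nextCenters close R a cen j = some b := by
  rw [nextCenters]
  by_cases hj : j = firstTrue (centerFlags close R a cen)
  · rw [← hj, Function.update_self, h]; rfl
  · rw [Function.update_of_ne hj, h]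

theorem finalCenters_eq_of_some {l : List ι} {cen : Fin c → Option ι} {j : Fin c} {b : ι}
    (h : cen j = some b) : finalCenters close R l cen j = some b := by
  induction l generalizing cen with
  | nil => exact h
  | cons a l ih => exact ih (nextCenters_eq_of_some h a)

/-- Every row is close to the center of its color. -/
theorem exists_center (hrefl : ∀ a, RowsClose close R a a)
    (hsymm : ∀ a b, RowsClose close R a b → RowsClose close R b a)
    (hpack : ∀ s : Finset ι, (s : Set ι).Pairwise (fun a b => ¬ RowsClose close R a b) →
      s.card ≤ c) (l : List ι) (cen : Fin c → Option ι) (hcen : CentersValid close R cen) (p : ℕ)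
    (hp : p < l.length) :
    ∃ b, finalCenters close R l cen ((centerColors close R l cen)[p]'(by
      rwa [length_centerColors])) = some b ∧ RowsClose close R l[p] b := by
  induction l generalizing cen p with
  | nil => simp at hp
  | cons a l ih =>
    have hex := hcen.exists_flag hrefl hsymm hpack a
    cases p with
    | zero =>
      obtain ⟨h1, -⟩ := firstTrue_spec hex
      -- A chosen center never changes, so the final center of this color is the one in force now:
      -- either `a` itself or a row that accepted `a`.
      simp only [finalCenters, centerColors, List.getElem_cons_zero]
      cases hj : cen (firstTrue (centerFlags close R a cen)) with
      | none =>
        refine ⟨a, finalCenters_eq_of_some ?_, hrefl a⟩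
        rw [nextCenters, Function.update_self, hj]
        rfl
      | some b =>
        refine ⟨b, finalCenters_eq_of_some (nextCenters_eq_of_some hj a), ?_⟩
        simpa [centerFlags, hj] using h1
    | succ p =>
      simpa [finalCenters, centerColors] using
        ih (nextCenters close R a cen) (hcen.next hsymm hex) p (by simpa using hp)

/-- The colors that the greedy net gives to the rows of a matrix: rows of equal color are close to
a common row. -/
theorem exists_netColors_eq_ofFn (R : Fin N → Fin N → Q)
    (hrefl : ∀ a, RowsClose close R a a)
    (hsymm : ∀ a b, RowsClose close R a b → RowsClose close R b a)
    (hpack : ∀ s : Finset (Fin N), (s : Set (Fin N)).Pairwise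
      (fun a b => ¬ RowsClose close R a b) → s.card ≤ c) :
    ∃ col : Fin N → Fin c,
      netColors close (List.ofFn fun a => List.ofFn (R a)) [] = List.ofFn col ∧
      ∀ a b, col a = col b → ∃ d, RowsClose close R a d ∧ RowsClose close R b d := by
  have hcen : CentersValid (c := c) close R fun _ => none :=
    ⟨by simp, by simp⟩
  have h1 := netColors_eq_centerColors close R (List.finRange N) (fun _ : Fin c => none) []
    (Or.inr ⟨rfl, rfl⟩)
  have hlen := length_centerColors close R (List.finRange N) (fun _ : Fin c => none)
  rw [List.length_finRange] at hlen
  refine ⟨fun a => (centerColors close R (List.finRange N) fun _ => none)[a.1]'(by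
    rw [hlen]; exact a.2), ?_, fun a b hab => ?_⟩
  · rw [List.ofFn_eq_map, h1]
    refine List.ext_getElem (by simp [hlen]) fun p _ _ => by simp
  · obtain ⟨x, hx, hx'⟩ := exists_center hrefl hsymm hpack (List.finRange N) _ hcen a.1 (by simp)
    obtain ⟨y, hy, hy'⟩ := exists_center hrefl hsymm hpack (List.finRange N) _ hcen b.1 (by simp)
    simp only [List.getElem_finRange, Fin.cast_mk, Fin.eta] at hx' hy' hab
    rw [hab, hy] at hx
    obtain rfl := Option.some.inj hx
    exact ⟨_, hx', hy'⟩

end NetCorrect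

/-! ### Sampling -/

/-- The counter skips the rest of a block. The end of the induction is `i = L`, where the counter
has wrapped to 0; this also covers `L = 1`. -/
theorem sample_append_of_pos {L : ℕ} [NeZero L] {α : Type} (w rest : List α) (i : ℕ) (hi : 0 < i)
    (h : i + w.length = L) : sample (Fin.ofNat L i) (w ++ rest) = sample (0 : Fin L) rest := by
  induction w generalizing i with
  | nil =>
    simp only [List.length_nil, Nat.add_zero] at h
    subst h
    congr 1
    ext
    simp
  | cons a w ih =>
    simp only [List.length_cons] at h
    have hne : Fin.ofNat L i ≠ 0 := by
      intro h0
      have := congrArg Fin.val h0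
      simp only [Fin.val_ofNat, Fin.val_zero] at this
      rw [Nat.mod_eq_of_lt (by omega)] at this
      omega
    have hs : Fin.ofNat L i + 1 = Fin.ofNat L (i + 1) := by
      ext
      simp [Fin.val_add]
    rw [List.cons_append, sample, if_neg hne, hs, ih (i + 1) (by omega) (by omega)]
    rfl

theorem sample_append {L : ℕ} [NeZero L] {α : Type} (a : α) (w rest : List α)
    (h : w.length + 1 = L) :
    sample (0 : Fin L) (a :: w ++ rest) = a :: sample (0 : Fin L) rest := by
  have hs : (0 : Fin L) + 1 = Fin.ofNat L 1 := by
    ext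
    simp
  rw [List.cons_append, sample, if_pos rfl, hs, sample_append_of_pos w rest 1 one_pos (by omega)]
  rfl

theorem sample_ofFn {L : ℕ} [NeZero L] {α : Type} (n : ℕ) (g : Fin (n * L) → α) :
    sample (0 : Fin L) (List.ofFn g) =
      List.ofFn fun v : Fin n => g (finProdFinEquiv (v, (0 : Fin L))) := by
  have key : ∀ (n : ℕ) (g : Fin n → Fin L → α),
      sample (0 : Fin L) (List.ofFn fun v => List.ofFn (g v)).flatten =
        List.ofFn fun v => g v 0 := by
    intro n g
    induction n with
    | zero => simp [sample]
    | succ n ih =>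
      rw [List.ofFn_succ, List.flatten_cons, List.ofFn_succ (f := fun v => g v 0), ← ih]
      obtain ⟨L', rfl⟩ : ∃ L', L = L' + 1 := ⟨L - 1, by have := NeZero.pos L; omega⟩
      rw [List.ofFn_succ (f := g 0), sample_append _ _ _ (by simp)]
  rw [List.ofFn_mul, key n fun v b => g ⟨v * L + b, _⟩]
  congr 1
  funext v
  congr 1
  ext
  simp [finProdFinEquiv, mul_comm]

/-! ### Comparing fractions digit by digit -/

section Carry

/-- The number with given binary digits, the lowest one first. -/
def bitsVal : List Bool → ℕ
  | [] => 0
  | b :: bs => b.toNat + 2 * bitsVal bs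

theorem bitsVal_encodePosNum (n : PosNum) : bitsVal (encodePosNum n) = n := by
  induction n with
  | one => simp [encodePosNum, bitsVal]
  | bit0 n ih => simp [encodePosNum, bitsVal, ih, two_mul]
  | bit1 n ih => simp [encodePosNum, bitsVal, ih, two_mul]; omega

theorem bitsVal_encodeNat (n : ℕ) : bitsVal (encodeNat n) = n := by
  have h : ∀ m : Num, bitsVal (encodeNum m) = m := by
    intro m
    cases m with
    | zero => simp [encodeNum, bitsVal]
    | pos m => simp [encodeNum, bitsVal_encodePosNum]
  rw [encodeNat, h]
  simp

/-! ### A finite automaton for the signs of `H p - j q` -/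

variable {H J : ℕ}

/-- The carries that occur when `H p - j q` is computed for some `j ≤ J`. -/
abbrev Carry (H J : ℕ) : Type := Set.Icc (-((H + J : ℕ) : ℤ)) ((H + J : ℕ) : ℤ)

/-- The carries after one further digit of `p` and `q` is read. -/
def updateCarry (st : Fin (J + 1) → Carry H J) (p q : Bool) (j : Fin (J + 1)) : Carry H J :=
  Set.projIcc _ _ (by omega) (((st j : ℤ) + H * p.toNat - (j : ℕ) * q.toNat) / 2)

/-- The projection never truncates: halving keeps a carry of absolute value at most `H + J` in this
range after a summand between `-J` and `H` is added. This is why finitely many states suffice. -/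
theorem coe_updateCarry (st : Fin (J + 1) → Carry H J) (p q : Bool) (j : Fin (J + 1)) :
    (updateCarry st p q j : ℤ) = ((st j : ℤ) + H * p.toNat - (j : ℕ) * q.toNat) / 2 := by
  have h1 := (st j).2.1
  have h2 := (st j).2.2
  have hj : (j : ℕ) ≤ J := by omega
  rw [updateCarry, Set.projIcc_of_mem]
  constructor <;> cases p <;> cases q <;> simp at h1 h2 ⊢ <;> omega

/-- The initial carries. -/
def zeroCarry (H J : ℕ) (_ : Fin (J + 1)) : Carry H J := ⟨0, by simp; omega⟩

/-- Splitting off the lowest digits leaves `y + 2 * z`, which is nonnegative iff `y / 2 + z` is,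
with division rounding down. So the sign survives when only the rounded carry is kept. -/
theorem runDigits_updateCarry_nonneg (st : Fin (J + 1) → Carry H J) (ps qs : List Bool)
    (j : Fin (J + 1)) : 0 ≤ (runDigits updateCarry st ps qs j : ℤ) ↔
      0 ≤ (st j : ℤ) + H * bitsVal ps - (j : ℕ) * bitsVal qs := by
  have key : ∀ (s h p i q : ℤ) (a b : Bool),
      0 ≤ (s + h * a.toNat - i * b.toNat) / 2 + h * p - i * q ↔
      0 ≤ s + h * (a.toNat + 2 * p) - i * (b.toNat + 2 * q) := by
    intro s h p i q a b
    have e : s + h * (a.toNat + 2 * p) - i * (b.toNat + 2 * q) =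
      (s + h * a.toNat - i * b.toNat) + 2 * (h * p - i * q) := by ring
    rw [e, add_sub_assoc]
    generalize h * p - i * q = z
    generalize s + h * a.toNat - i * b.toNat = y
    omega
  induction st, ps, qs using runDigits.induct (upd := updateCarry) with
  | case1 st => simp [runDigits, bitsVal]
  | case2 st p ps ih =>
    rw [runDigits]
    refine Iff.trans ih ?_
    rw [coe_updateCarry]
    simpa [bitsVal] using key (st j) H (bitsVal ps) (j : ℕ) 0 p false
  | case3 st q qs ih =>
    rw [runDigits]
    refine Iff.trans ih ?_
    rw [coe_updateCarry]
    simpa [bitsVal] using key (st j) H 0 (j : ℕ) (bitsVal qs) false q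
  | case4 st p ps q qs ih =>
    rw [runDigits]
    refine Iff.trans ih ?_
    rw [coe_updateCarry]
    simpa [bitsVal] using key (st j) H (bitsVal ps) (j : ℕ) (bitsVal qs) p q

/-- A sign and a level at most `J`. -/
abbrev Level (J : ℕ) : Type := Bool × Fin (J + 1)

/-- The level is the greatest `j ≤ J` with `j q ≤ H p`. -/
def levelOfCarry (s : Bool) (st : Fin (J + 1) → Carry H J) : Level J :=
  (s, ⟨Nat.findGreatest (fun j => 0 ≤ (st (Fin.ofNat (J + 1) j) : ℤ)) J,
    Nat.lt_succ_of_le (Nat.findGreatest_le J)⟩)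

/-- The integer that a signed level stands for. -/
def Level.val (x : Level J) : ℤ := if x.1 then -(x.2 : ℕ) else (x.2 : ℕ)

/-- The level of a rational number. -/
def ratLevel (H J : ℕ) (q : ℚ) : Level J := roundRat (zeroCarry H J) updateCarry levelOfCarry q

/-- The level is the integer part of `H * |q|`, with the sign attached; the hypothesis excludes
saturation at `J`. -/
theorem abs_val_ratLevel_sub_le {q : ℚ} (hq : H * |q| ≤ J) :
    |((ratLevel H J q).val : ℚ) - H * q| ≤ 1 := by
  set l := H * q.num.natAbs / q.den with hl
  have hden : (0 : ℚ) < q.den := by exact_mod_cast q.pos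
  have habs : |q| = q.num.natAbs / q.den := by
    conv_lhs => rw [← Rat.num_div_den q]
    rw [abs_div, abs_of_pos hden]
    congr 1
    rw [Nat.cast_natAbs, Int.cast_abs]
  have h1 : (l : ℚ) ≤ H * |q| := by
    rw [habs, ← mul_div_assoc, le_div_iff₀ hden]
    exact_mod_cast Nat.div_mul_le_self _ _
  have h2 : H * |q| < l + 1 := by
    rw [habs, ← mul_div_assoc, div_lt_iff₀ hden]
    rw [mul_comm _ (q.den : ℚ)]
    exact_mod_cast Nat.lt_mul_div_succ (H * q.num.natAbs) q.pos
  have hlJ : l ≤ J := by exact_mod_cast h1.trans hq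
  have hlev : ((ratLevel H J q).2 : ℕ) = l := by
    have hP : ∀ j ≤ J, 0 ≤ (runDigits updateCarry (zeroCarry H J) (encodeNat q.num.natAbs)
        (encodeNat q.den) (Fin.ofNat (J + 1) j) : ℤ) ↔ j ≤ l := by
      intro j hj
      rw [runDigits_updateCarry_nonneg, bitsVal_encodeNat, bitsVal_encodeNat, hl,
        Nat.le_div_iff_mul_le q.pos, Fin.val_ofNat, Nat.mod_eq_of_lt (by omega)]
      simp only [zeroCarry, zero_add, sub_nonneg]
      exact_mod_cast Iff.rfl
    change Nat.findGreatest _ J = l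
    rw [Nat.findGreatest_eq_iff]
    refine ⟨hlJ, fun _ => (hP l hlJ).2 le_rfl, fun n hn hnJ h => ?_⟩
    exact absurd ((hP n hnJ).1 h) (by omega)
  have hsgn : (ratLevel H J q).1 = decide (q < 0) := rfl
  rw [Level.val, hlev, hsgn]
  by_cases h : q < 0
  · rw [abs_of_neg h] at h1 h2
    simp only [h, decide_true, if_true]
    push_cast
    rw [abs_le]
    constructor <;> linarith
  · rw [abs_of_nonneg (not_lt.1 h)] at h1 h2
    simp only [h, decide_false, Bool.false_eq_true, if_false]
    push_cast
    rw [abs_le]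
    constructor <;> linarith

end Carry

/-! ### Separated rows of a matrix of small rank -/

section Packing

open MeasureTheory Metric Module Function
open scoped ENNReal

/-- Balls of radius `d / 2` around the points are disjoint and lie in the ball of radius `R + d /
2`. Comparing Haar measures gives the ratio of the radii to the power of the dimension. -/
theorem card_le_of_separated {E : Type*} [NormedAddCommGroup E] [NormedSpace ℝ E]
    [FiniteDimensional ℝ E] (s : Finset E) {R d : ℝ} (hR : 0 ≤ R) (hd : 0 < d)
    (hs : ∀ x ∈ s, ‖x‖ ≤ R) (h : ∀ x ∈ s, ∀ y ∈ s, x ≠ y → d ≤ ‖x - y‖) :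
    (s.card : ℝ) ≤ (2 * R / d + 1) ^ finrank ℝ E := by
  borelize E
  let μ : Measure E := Measure.addHaar
  let δ : ℝ := d / 2
  let ρ : ℝ := R + d / 2
  have δpos : 0 < δ := by positivity
  have ρpos : 0 < ρ := by positivity
  set A := ⋃ x ∈ s, ball (x : E) δ with hA
  have D : Set.Pairwise (s : Set E) (Disjoint on fun x => ball (x : E) δ) := by
    rintro x hx y hy hxy
    apply ball_disjoint_ball
    rw [dist_eq_norm]
    have := h x hx y hy hxy
    simp only [δ]
    linarith
  have A_subset : A ⊆ ball (0 : E) ρ := by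
    refine Set.iUnion₂_subset fun x hx => ?_
    apply ball_subset_ball'
    rw [dist_zero_right]
    have := hs x hx
    simp only [δ, ρ]
    linarith
  have I : (s.card : ℝ≥0∞) * ENNReal.ofReal (δ ^ finrank ℝ E) * μ (ball 0 1) ≤
      ENNReal.ofReal (ρ ^ finrank ℝ E) * μ (ball 0 1) :=
    calc
      (s.card : ℝ≥0∞) * ENNReal.ofReal (δ ^ finrank ℝ E) * μ (ball 0 1) = μ A := by
        rw [hA, measure_biUnion_finset D fun c _ => measurableSet_ball]
        simp only [μ.addHaar_ball_of_pos _ δpos]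
        simp only [Finset.sum_const, nsmul_eq_mul, mul_assoc]
      _ ≤ μ (ball (0 : E) ρ) := measure_mono A_subset
      _ = ENNReal.ofReal (ρ ^ finrank ℝ E) * μ (ball 0 1) := by
        simp only [μ.addHaar_ball_of_pos _ ρpos]
  have I' : (s.card : ℝ≥0∞) * ENNReal.ofReal (δ ^ finrank ℝ E) ≤
      ENNReal.ofReal (ρ ^ finrank ℝ E) :=
    (ENNReal.mul_le_mul_iff_left (measure_ball_pos _ _ zero_lt_one).ne' measure_ball_lt_top.ne).1 I
  have I'' := ENNReal.toReal_le_of_le_ofReal (pow_nonneg ρpos.le _) I'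
  rw [ENNReal.toReal_mul, ENNReal.toReal_natCast, ENNReal.toReal_ofReal (by positivity),
    ← le_div_iff₀ (by positivity), ← div_pow] at I''
  refine I''.trans (le_of_eq ?_)
  congr 1
  simp only [ρ, δ]
  field_simp

/-- A bound, independent of the size of the matrix, for the number of separated rows of a bounded
matrix of small rank. -/
theorem card_le_of_separated_rows {N r : ℕ} {c d : ℝ} (hc : 0 ≤ c) (hd : 0 < d)
    {B : Matrix (Fin N) (Fin N) ℝ} (hB : B.rank ≤ r) (hBc : ∀ i j, |B i j| ≤ c)
    (s : Finset (Fin N))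
    (hs : (s : Set (Fin N)).Pairwise fun a b => ∃ w, d ≤ |B a w - B b w|) :
    (s.card : ℝ) ≤ (2 * c / d + 1) ^ r := by
  classical
  -- The row space carries the sup norm of `Fin N → ℝ`. Only its dimension, the rank, enters the
  -- volume bound, for any norm; so `N` disappears.
  let E := Submodule.span ℝ (Set.range B)
  let g : Fin N → E := fun a => ⟨B a, Submodule.subset_span ⟨a, rfl⟩⟩
  have hsep : ∀ a ∈ s, ∀ b ∈ s, a ≠ b → d ≤ ‖g a - g b‖ := by
    intro a ha b hb hab
    obtain ⟨w, hw⟩ := hs ha hb hab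
    calc d ≤ ‖(B a - B b) w‖ := by simpa [Real.norm_eq_abs] using hw
      _ ≤ ‖B a - B b‖ := norm_le_pi_norm _ _
      _ = ‖g a - g b‖ := rfl
  have hinj : Set.InjOn g s := by
    intro a ha b hb hab
    by_contra hne
    have := hsep a ha b hb hne
    rw [hab, sub_self, norm_zero] at this
    linarith
  have h := card_le_of_separated (s.image g) (R := c) (d := d) hc hd
    (by
      intro x hx
      obtain ⟨a, -, rfl⟩ := Finset.mem_image.1 hx
      change ‖B a‖ ≤ c
      exact (pi_norm_le_iff_of_nonneg hc).2 fun w => by simpa [Real.norm_eq_abs] using hBc a w)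
    (by
      intro x hx y hy hxy
      obtain ⟨a, ha, rfl⟩ := Finset.mem_image.1 hx
      obtain ⟨b, hb, rfl⟩ := Finset.mem_image.1 hy
      exact hsep a ha b hb fun h => hxy (by rw [h]))
  rw [Finset.card_image_of_injOn hinj] at h
  refine h.trans (pow_le_pow_right₀ ?_ ?_)
  · have : 0 ≤ 2 * c / d := by positivity
    linarith
  · refine le_trans (le_of_eq ?_) hB
    exact (Matrix.rank_eq_finrank_span_row B).symm

end Packing

/-! ### Membership matrices of balanced partitions -/

section Coherence

variable {N k s : ℕ}

/-- The matrix that tells which pairs belong to the same class. -/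
def classMatrix (cls : Fin N → Fin k) : Matrix (Fin N) (Fin N) ℝ :=
  Matrix.of fun x y => if cls x = cls y then 1 else 0

/-- If all classes have the same size, the matrix has the least possible coherence. -/
theorem hasRankCoherence_classMatrix (hk : 0 < k) (hs : 0 < s) {cls : Fin N → Fin k}
    (hcls : ∀ l, (Finset.univ.filter fun x => cls x = l).card = s) {μ : ℝ} (hμ : 1 ≤ μ) :
    HasRankCoherence k μ (classMatrix cls) := by
  have hs0 : (0 : ℝ) < s := by exact_mod_cast hs
  have hN : N = k * s := by
    have h := Finset.card_eq_sum_card_fiberwise (s := (Finset.univ : Finset (Fin N)))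
      (t := (Finset.univ : Finset (Fin k))) (f := cls) (by simp)
    simpa [hcls] using h
  -- The columns are the normalized indicators of the classes. All singular values are `s`, and each
  -- row has squared norm `1 / s = k / N`.
  let U : Matrix (Fin N) (Fin k) ℝ := Matrix.of fun x l => if cls x = l then 1 / √s else 0
  have hsq : 1 / √(s : ℝ) * (1 / √s) = 1 / s := by
    rw [div_mul_div_comm, Real.mul_self_sqrt hs0.le, one_mul]
  have hUU : U.transpose * U = 1 := by
    ext l l'
    rw [Matrix.mul_apply]
    simp only [U, Matrix.transpose_apply, Matrix.of_apply, mul_ite, ite_mul, zero_mul, mul_zero]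
    by_cases h : l = l'
    · subst h
      rw [Matrix.one_apply_eq]
      calc (∑ x, if cls x = l then (if cls x = l then 1 / √(s : ℝ) * (1 / √s) else 0) else 0)
          = ∑ x, if cls x = l then 1 / (s : ℝ) else 0 := by
            refine Finset.sum_congr rfl fun x _ => ?_
            split_ifs
            · exact hsq
            · rfl
        _ = 1 := by
            rw [← Finset.sum_filter, Finset.sum_const, hcls, nsmul_eq_mul]
            field_simp
    · rw [Matrix.one_apply_ne h]
      refine Finset.sum_eq_zero fun x _ => ?_
      split_ifs with h1 h2
      · exact absurd (h2.symm.trans h1) h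
      · rfl
      · rfl
  let σ : Fin k → ℝ := fun _ => s
  have hM : classMatrix cls = U * Matrix.diagonal σ * U.transpose := by
    ext x y
    rw [Matrix.mul_apply]
    simp only [Matrix.mul_diagonal, U, σ, Matrix.transpose_apply, Matrix.of_apply, classMatrix,
      mul_ite, ite_mul, zero_mul, mul_zero, Finset.sum_ite_eq, Finset.mem_univ, if_true]
    have : 1 / √(s : ℝ) * s * (1 / √s) = 1 := by
      rw [mul_right_comm, hsq]
      field_simp
    simp only [this]
  have hrow : ∀ x, ‖WithLp.toLp 2 (U x)‖ ≤ √(k * μ / N) := by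
    intro x
    rw [EuclideanSpace.norm_eq]
    refine Real.sqrt_le_sqrt ?_
    have h1 : ∑ l, ‖(WithLp.toLp 2 (U x)) l‖ ^ 2 = 1 / (s : ℝ) := by
      calc ∑ l, ‖(WithLp.toLp 2 (U x)) l‖ ^ 2 = ∑ l, if cls x = l then 1 / (s : ℝ) else 0 := by
            refine Finset.sum_congr rfl fun l _ => ?_
            simp only [U, Matrix.of_apply, Real.norm_eq_abs, sq_abs]
            split_ifs
            · rw [sq, hsq]
            · simp
        _ = 1 / s := by simp
    rw [h1, hN]
    have hk0 : (0 : ℝ) < k := by exact_mod_cast hk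
    push_cast
    rw [mul_div_mul_left _ _ hk0.ne']
    exact div_le_div_of_nonneg_right hμ hs0.le
  refine ⟨le_antisymm ?_ ?_, U, U, σ, hUU, hUU, fun _ => hs0, hM, hrow, hrow⟩
  · rw [hM, Matrix.mul_assoc]
    exact (Matrix.rank_mul_le_left _ _).trans (by simpa using Matrix.rank_le_width U)
  · have h1 : U.transpose * classMatrix cls * U = Matrix.diagonal σ := by
      rw [hM]
      calc U.transpose * (U * Matrix.diagonal σ * U.transpose) * U
          = (U.transpose * U) * Matrix.diagonal σ * (U.transpose * U) := by
            simp only [Matrix.mul_assoc]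
        _ = _ := by rw [hUU, Matrix.one_mul, Matrix.mul_one]
    have h2 : (Matrix.diagonal σ).rank = k := by
      rw [Matrix.rank_of_isUnit]
      · simp
      · rw [Matrix.isUnit_iff_isUnit_det, Matrix.det_diagonal]
        simp [σ, hs.ne']
    calc k = (U.transpose * classMatrix cls * U).rank := by rw [h1, h2]
      _ ≤ (U.transpose * classMatrix cls).rank := Matrix.rank_mul_le_left _ _
      _ ≤ (classMatrix cls).rank := Matrix.rank_mul_le_right _ _

end Coherence

/-! ### The instance of the completion problem -/

section Instance

variable {n k : ℕ}

/-- The entry in row `a` and column `b` of the block that replaces a mark. The indices are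
`21` groups of `k`; the first group stands for `k` copies of a vertex, and the classes of the others
are given by their second coordinates. -/
def blockEntry (m : Mark) (a b : Fin (21 * k)) : Option ℚ :=
  if a.divNat ≠ 0 ∧ b.divNat ≠ 0 then some (if a.modNat = b.modNat then 1 else 0)
  else if a = b then
    match m with
    | .diag => some 1
    | .edge => some 0
    | .non => none
  else none

theorem blockEntry_comm (m : Mark) (a b : Fin (21 * k)) : blockEntry m a b = blockEntry m b a := by
  simp only [blockEntry, and_comm (a := a.divNat ≠ 0), eq_comm (a := a.modNat), eq_comm (a := a)]

/-- The partial matrix that is composed of the blocks of the marks. -/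
def blockMatrix (k : ℕ) (rel : Fin n → Fin n → Mark) :
    Matrix (Fin (n * (21 * k))) (Fin (n * (21 * k))) (Option ℚ) :=
  Matrix.of fun x y => blockEntry (rel x.divNat y.divNat) x.modNat y.modNat

/-- The classes of the indices of the block matrix that belong to a coloring. -/
def blockClass (χ : Fin n → Fin k) (x : Fin (n * (21 * k))) : Fin k :=
  if x.modNat.divNat ≠ 0 then x.modNat.modNat else χ x.divNat + x.modNat.modNat

theorem sum_block {β : Type*} [AddCommMonoid β] (f : Fin n → Fin 21 → Fin k → β) :
    ∑ x : Fin (n * (21 * k)), f x.divNat x.modNat.divNat x.modNat.modNat =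
      ∑ v, ∑ i, ∑ a, f v i a := by
  refine (Fintype.sum_equiv finProdFinEquiv.symm _
    (fun p : Fin n × Fin (21 * k) => f p.1 p.2.divNat p.2.modNat) (fun _ => rfl)).trans ?_
  rw [Fintype.sum_prod_type]
  refine Finset.sum_congr rfl fun v _ => ?_
  refine (Fintype.sum_equiv finProdFinEquiv.symm _ (fun p : Fin 21 × Fin k => f v p.1 p.2)
    (fun _ => rfl)).trans ?_
  rw [Fintype.sum_prod_type]

/-- In every group of `k` indices each class occurs exactly once: in the first group because `a ↦ χ
v + a` is a bijection of `Fin k`, in the others by definition. So the classes are balanced even if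
the color classes of `χ` are not. -/
theorem card_blockClass (χ : Fin n → Fin k) (l : Fin k) :
    (Finset.univ.filter fun x => blockClass χ x = l).card = n * 21 := by
  have : NeZero k := ⟨by have := l.2; omega⟩
  rw [Finset.card_filter]
  have h := sum_block (n := n) (k := k) fun v i a =>
    if (if i ≠ 0 then a else χ v + a) = l then 1 else 0
  refine h.trans ?_
  have h1 : ∀ (v : Fin n) (i : Fin 21),
      (∑ a, if (if i ≠ 0 then a else χ v + a) = l then 1 else 0) = 1 := by
    intro v i
    by_cases hi : i ≠ 0
    · simp [hi]
    · simp only [hi, if_false]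
      rw [Finset.sum_eq_single (l - χ v)]
      · simp
      · intro a _ ha
        rw [if_neg]
        rintro rfl
        exact ha (by simp)
      · simp
  simp only [h1]
  simp

/-- Copies of two vertices are compared only if they have the same shift `a`, and then `χ v + a = χ
w + a` iff `χ v = χ w`; so 1 on the diagonal and 0 at edges are correct for every proper `χ`.
Entries that would depend on the unknown colors are hidden, so `χ` is needed only to exhibit the
underlying matrix. -/
theorem isInstance_blockMatrix (hk : 0 < k) (hn : 0 < n) {rel : Fin n → Fin n → Mark}
    (hdiag : ∀ v w, rel v w = .diag ↔ v = w) (hsymm : ∀ v w, rel v w = rel w v)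
    {χ : Fin n → Fin k} (hχ : ∀ v w, rel v w = .edge → χ v ≠ χ w) {c μ : ℝ} (hc : 1 ≤ c)
    (hμ : 1 ≤ μ) : IsInstance k (9 / 10) c μ (blockMatrix k rel) := by
  have : NeZero k := ⟨by omega⟩
  refine ⟨?_, ?_, classMatrix (blockClass χ), ?_,
    hasRankCoherence_classMatrix hk (s := n * 21) (by omega) (card_blockClass χ) hμ, ?_, ?_⟩
  · refine Matrix.ext fun x y => ?_
    rw [Matrix.transpose_apply, blockMatrix, Matrix.of_apply, Matrix.of_apply, hsymm,
      blockEntry_comm]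
  · have hsub : (Finset.univ.filter fun x : Fin (n * (21 * k)) => x.modNat.divNat ≠ 0) ×ˢ
        (Finset.univ.filter fun x : Fin (n * (21 * k)) => x.modNat.divNat ≠ 0) ⊆
        revealed (blockMatrix k rel) := by
      intro p hp
      simp only [Finset.mem_product, Finset.mem_filter, Finset.mem_univ, true_and] at hp
      rw [revealed, Finset.mem_filter]
      simp [blockMatrix, blockEntry, hp.1, hp.2]
    have hcard : (Finset.univ.filter fun x : Fin (n * (21 * k)) =>
        x.modNat.divNat ≠ 0).card = n * (20 * k) := by
      rw [Finset.card_filter]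
      refine (sum_block (n := n) (k := k) fun _ i _ => if i ≠ 0 then 1 else 0).trans ?_
      simp only [Finset.sum_const, Finset.card_univ, Fintype.card_fin, smul_eq_mul]
      rw [← Finset.mul_sum, ← Finset.card_filter]
      have : (Finset.univ.filter fun i : Fin 21 => i ≠ 0).card = 20 := by decide
      rw [this]
      ring
    have h := Finset.card_le_card hsub
    rw [Finset.card_product, hcard] at h
    have h' : ((n * (20 * k) * (n * (20 * k)) : ℕ) : ℝ) ≤ (revealed (blockMatrix k rel)).card := by
      exact_mod_cast h
    refine le_trans ?_ h'
    -- With `20` of `21` groups revealed against each other, the claim is `9 / 10 * 21 ^ 2 ≤ 20 ^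
    -- 2`, that is `396.9 ≤ 400`.
    push_cast
    nlinarith [sq_nonneg ((n : ℝ) * k)]
  · ext x y
    simp [classMatrix, eq_comm]
  · intro x y
    rw [classMatrix, Matrix.of_apply]
    split_ifs
    · simpa using hc
    · simpa using zero_le_one.trans hc
  · intro x y q hq
    simp only [blockMatrix, Matrix.of_apply, blockEntry] at hq
    simp only [classMatrix, Matrix.of_apply, blockClass]
    by_cases h1 : x.modNat.divNat ≠ 0 ∧ y.modNat.divNat ≠ 0
    · rw [if_pos h1, Option.some.injEq] at hq
      subst hq
      simp only [ne_eq, h1.1, h1.2, not_false_eq_true, if_true]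
      split_ifs <;> simp
    rw [if_neg h1] at hq
    by_cases h2 : x.modNat = y.modNat
    · rw [if_pos h2] at hq
      have h0 : ¬ (x.modNat.divNat ≠ 0) := fun h => h1 ⟨h, h2 ▸ h⟩
      have h0' : ¬ (y.modNat.divNat ≠ 0) := h2 ▸ h0
      simp only [h0', if_false, h2, add_left_inj]
      cases hm : rel x.divNat y.divNat with
      | diag =>
        rw [hm] at hq
        simp only [Option.some.injEq] at hq
        rw [(hdiag _ _).1 hm, ← hq]
        simp
      | edge =>
        rw [hm] at hq
        simp only [Option.some.injEq] at hq
        rw [if_neg (hχ _ _ hm), ← hq]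
        simp
      | non =>
        rw [hm] at hq
        simp at hq
    · simp [h2] at hq

end Instance

/-! ### The words of graphs and of their instances -/

section Words

variable {n k : ℕ}

theorem divNat_finProdFinEquiv {m l : ℕ} (v : Fin m) (a : Fin l) :
    (finProdFinEquiv (v, a)).divNat = v :=
  congrArg Prod.fst (finProdFinEquiv.symm_apply_apply (v, a))

theorem modNat_finProdFinEquiv {m l : ℕ} (v : Fin m) (a : Fin l) :
    (finProdFinEquiv (v, a)).modNat = a :=
  congrArg Prod.snd (finProdFinEquiv.symm_apply_apply (v, a))

/-- The flat indices in increasing order run through the blocks one after the other, as the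
expanding and the sampling machine do. -/
theorem finRange_mul (m l : ℕ) : List.finRange (m * l) =
    (List.finRange m).flatMap fun v => (List.finRange l).map fun a => finProdFinEquiv (v, a) := by
  have h := List.ofFn_mul (m := m) (n := l) (fun x : Fin (m * l) => x)
  rw [List.ofFn_eq_map, List.map_id'] at h
  rw [h, List.flatMap_def, ← List.ofFn_eq_map]
  congr 2
  funext v
  rw [← List.ofFn_eq_map]
  congr 1
  funext a
  ext
  simp [finProdFinEquiv, mul_comm, add_comm]

open Classical in
/-- The relation between the vertices of a graph to which an isolated vertex is added. -/
noncomputable def graphMark (G : SimpleGraph (Fin n)) (v w : Fin (n + 1)) : Mark :=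
  if v = w then .diag
  else if ∃ (hv : v.1 < n) (hw : w.1 < n), G.Adj ⟨v, hv⟩ ⟨w, hw⟩ then .edge
  else .non

theorem graphMark_eq_diag_iff (G : SimpleGraph (Fin n)) (v w : Fin (n + 1)) :
    graphMark G v w = .diag ↔ v = w := by
  rw [graphMark]
  split_ifs <;> simp_all

theorem graphMark_comm (G : SimpleGraph (Fin n)) (v w : Fin (n + 1)) :
    graphMark G v w = graphMark G w v := by
  have h : (∃ (hv : v.1 < n) (hw : w.1 < n), G.Adj ⟨v, hv⟩ ⟨w, hw⟩) ↔
      ∃ (hw : w.1 < n) (hv : v.1 < n), G.Adj ⟨w, hw⟩ ⟨v, hv⟩ :=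
    ⟨fun ⟨a, b, h⟩ => ⟨b, a, h.symm⟩, fun ⟨a, b, h⟩ => ⟨b, a, h.symm⟩⟩
  classical
  rw [graphMark, graphMark]
  by_cases hvw : v = w
  · rw [if_pos hvw, if_pos hvw.symm]
  · rw [if_neg hvw, if_neg (Ne.symm hvw)]
    exact if_congr h rfl rfl

theorem exists_adj_of_graphMark_eq_edge {G : SimpleGraph (Fin n)} {v w : Fin (n + 1)}
    (h : graphMark G v w = .edge) :
    ∃ (hv : v.1 < n) (hw : w.1 < n), G.Adj ⟨v, hv⟩ ⟨w, hw⟩ := by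
  rw [graphMark] at h
  split_ifs at h with h1 h2
  exact h2

theorem graphMark_castSucc_of_adj {G : SimpleGraph (Fin n)} {v w : Fin n} (h : G.Adj v w) :
    graphMark G v.castSucc w.castSucc = .edge := by
  rw [graphMark, if_neg (fun e => h.ne (Fin.castSucc_injective n e)), if_pos]
  exact ⟨v.2, w.2, h⟩

open Classical in
/-- The rows of the adjacency matrix. -/
noncomputable def graphRows (G : SimpleGraph (Fin n)) : List (List Bool) :=
  List.ofFn fun v => List.ofFn fun w => decide (G.Adj v w)

theorem encodeGraph_eq_graphRows (G : SimpleGraph (Fin n)) :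
    (graphRows G).flatMap (fun bs => bitsWord bs ++ [Γ'.ket]) = encodeGraph G := by
  simp only [encodeGraph, encodeMatrix, matrixRows, terminated, graphRows, bitsWord,
    List.ofFn_eq_map, List.flatMap_map, Matrix.of_apply]
  rfl

theorem markRow_ofFn (v : Fin n) (b : Fin n → Bool) :
    markRow v (List.ofFn b) = List.ofFn fun w => if v = w then .diag else markOfBool (b w) := by
  refine List.ext_getElem ?_ fun i h1 h2 => ?_
  · simp [markRow]; omega
  · have hi : i < n := by simpa using h2
    simp only [markRow, List.getElem_ofFn]
    rcases lt_trichotomy i v.1 with h | h | h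
    · rw [List.getElem_append_left (by simp; omega)]
      simp [Fin.ext_iff, h.ne']
    · rw [List.getElem_append_right (by simp; omega)]
      simp [h]
    · rw [List.getElem_append_right (by simp; omega)]
      obtain ⟨j, rfl⟩ : ∃ j, i = v.1 + 1 + j := ⟨i - (v.1 + 1), by omega⟩
      have e : v.1 + 1 + j - v.1 = j + 1 := by omega
      simp [Fin.ext_iff, e, h.ne]

theorem markRows_ofFn (m v : ℕ) (g : Fin m → List Bool) :
    markRows v (List.ofFn g) = List.ofFn fun i => markRow (v + i) (g i) ++ [.non] := by
  induction m generalizing v with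
  | zero => rfl
  | succ m ih =>
    rw [List.ofFn_succ, markRows, ih, List.ofFn_succ]
    simp only [Fin.val_zero, Nat.add_zero, Fin.val_succ]
    congr 2
    funext i
    rw [Nat.add_right_comm, Nat.add_assoc]

theorem markMatrix_graphRows (G : SimpleGraph (Fin n)) :
    markMatrix (graphRows G) = List.ofFn fun v => List.ofFn fun w => graphMark G v w := by
  rw [markMatrix, graphRows, markRows_ofFn, List.ofFn_succ', List.concat_eq_append]
  congr 1
  · congr 1
    funext v
    rw [Nat.zero_add, markRow_ofFn, List.ofFn_succ', List.concat_eq_append]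
    congr 2
    · funext w
      by_cases h : v = w
      · simp [h, graphMark]
      · by_cases hvw : G.Adj v w
        · rw [graphMark_castSucc_of_adj hvw]
          simp [h, hvw, markOfBool]
        · simp [graphMark, h, hvw, markOfBool]
    · simp [graphMark, Fin.castSucc_ne_last]
  · rw [List.ofFn_succ', List.concat_eq_append]
    congr 2
    · refine List.ext_getElem (by simp) fun i h1 h2 => ?_
      simp [graphMark, (Fin.castSucc_ne_last _).symm]
    · simp [graphMark]

/-- The word of a row of a block. -/
def blockWord (k : ℕ) (a : Fin (21 * k)) (m : Mark) : List Γ' :=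
  terminated Γ'.comma ((List.finRange (21 * k)).map fun b => encodeEntry (blockEntry m a b))

/-- The unary precision, ended by `ket`, is the header of the expanding machine, and copy `a` of a
row of marks is row `a` of the corresponding blocks. -/
theorem encodeQuery_blockMatrix (rel : Fin n → Fin n → Mark) (t : ℕ) :
    (List.replicate t (Γ'.bit true) ++ [Γ'.ket]) ++
      (List.ofFn fun v => List.ofFn fun w => rel v w).flatMap
        (expandRow (blockWord k) Γ'.ket 0) = encodeQuery (blockMatrix k rel) t := by
  simp only [encodeQuery, terminated, List.flatMap_cons, matrixRows, finRange_mul n,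
    List.ofFn_eq_map, List.map_flatMap, List.flatMap_assoc, List.flatMap_map, List.map_map,
    expandRow, List.drop_zero, blockWord, blockMatrix, Matrix.of_apply, divNat_finProdFinEquiv,
    modNat_finProdFinEquiv, Function.comp_apply]

end Words

/-- The instance of the completion problem that belongs to a colorable graph. -/
noncomputable def graphInstance {k : ℕ} (hk : 0 < k) {c μ : ℝ} (hc : 1 ≤ c) (hμ : 1 ≤ μ)
    (G : ColorableGraph k) : Instance k (9 / 10) c μ :=
  ⟨⟨(G.1.1 + 1) * (21 * k), blockMatrix k (graphMark G.1.2)⟩, by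
    obtain ⟨χ⟩ := G.2
    -- The added vertex is isolated and may get any color. It keeps the matrix nonempty even for the
    -- empty graph; an empty matrix would have rank 0 instead of `k`.
    refine isInstance_blockMatrix hk (Nat.succ_pos _) (graphMark_eq_diag_iff _) (graphMark_comm _)
      (χ := fun v => if hv : v.1 < G.1.1 then χ ⟨v, hv⟩ else ⟨0, hk⟩) (fun v w h => ?_) hc hμ
    obtain ⟨hv, hw, hadj⟩ := exists_adj_of_graphMark_eq_edge h
    simp only [hv, hw, dif_pos]
    exact χ.valid hadj⟩

/-- The precision `t` is the same for all graphs, so its unary word is part of the program. No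
coloring is computed: it occurs only in the proof that the query is admissible. -/
theorem polyTime_graphInstance {k : ℕ} (hk : 0 < k) {c μ : ℝ} (hc : 1 ≤ c) (hμ : 1 ≤ μ) (t : ℕ) :
    Nonempty (TM2ComputableInPolyTime (fun G : ColorableGraph k => encodeGraph G.1.2)
      (fun x : Instance k (9 / 10) c μ × ℕ => encodeQuery x.1.1.2 x.2)
      (fun G => (graphInstance hk hc hμ G, t))) := by
  have h1 := polyTime_mark (fun G : ColorableGraph k => graphRows G.1.2) (by
    intro G bs hbs
    simp only [graphRows, List.mem_ofFn] at hbs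
    obtain ⟨i, rfl⟩ := hbs
    simp [graphRows])
  have h2 := polyTime_expand (List.replicate t (Γ'.bit true) ++ [Γ'.ket]) (blockWord k) Γ'.ket
  refine polyTime_congr id (fun G => encodeGraph_eq_graphRows _) (fun G => ?_)
    (polyTime_comp h1 h2)
  simp only [Function.comp_apply, id, markMatrix_graphRows]
  exact encodeQuery_blockMatrix (graphMark G.1.2) t

/-! ### From completions to colorings -/

/-- Whether two rounded entries are close. -/
def levelsClose {J : ℕ} (x y : Level J) : Bool := decide (|x.val - y.val| ≤ 4)

/-- Equal colors of the net of rounded rows force entries of the completion to be close, and the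
number of colors suffices. -/
theorem exists_netColors_of_approx {N r H K : ℕ} [NeZero K] {c : ℝ} (hc : 0 ≤ c) (hH : 0 < H)
    (hK : (2 * c / (1 / H) + 1) ^ r ≤ K) {B : Matrix (Fin N) (Fin N) ℝ} (hB : B.rank ≤ r)
    (hBc : ∀ i j, |B i j| ≤ c) {f : Matrix (Fin N) (Fin N) ℚ}
    (hf : ∀ i j, |(f i j : ℝ) - B i j| ≤ 1 / H) :
    ∃ col : Fin N → Fin K,
      netColors levelsClose (List.ofFn fun a => List.ofFn fun b =>
        ratLevel H (H * (⌈c⌉₊ + 1)) (f a b)) [] = List.ofFn col ∧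
      ∀ a b, col a = col b → ∀ w, |B a w - B b w| ≤ 12 / H := by
  have hH0 : (0 : ℝ) < H := by exact_mod_cast hH
  have hH1 : (1 : ℝ) / H ≤ 1 := by
    rw [div_le_one hH0]
    exact_mod_cast hH
  -- No level saturates, since the approximate entries are at most `⌈c⌉₊ + 1` in absolute value.
  set J := H * (⌈c⌉₊ + 1)
  -- At scale `H`, rounding and approximation contribute an error of at most 1 each.
  have hval : ∀ i j, |((ratLevel H J (f i j)).val : ℝ) - H * B i j| ≤ 2 := by
    intro i j
    have h1 : (H : ℝ) * |(f i j : ℝ)| ≤ J := by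
      have h2 : |(f i j : ℝ)| ≤ ⌈c⌉₊ + 1 := by
        have := abs_sub_abs_le_abs_sub (f i j : ℝ) (B i j)
        linarith [hf i j, hBc i j, Nat.le_ceil c]
      calc (H : ℝ) * |(f i j : ℝ)| ≤ H * (⌈c⌉₊ + 1) := mul_le_mul_of_nonneg_left h2 hH0.le
        _ = J := by simp [J]
    have h3 := abs_val_ratLevel_sub_le (H := H) (J := J) (q := f i j) (by exact_mod_cast h1)
    have h3' : |((ratLevel H J (f i j)).val : ℝ) - H * (f i j : ℝ)| ≤ 1 := by exact_mod_cast h3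
    have h4 : |(H : ℝ) * (f i j : ℝ) - H * B i j| ≤ 1 := by
      rw [← mul_sub, abs_mul, abs_of_pos hH0]
      calc (H : ℝ) * |(f i j : ℝ) - B i j| ≤ H * (1 / H) :=
            mul_le_mul_of_nonneg_left (hf i j) hH0.le
        _ = 1 := by field_simp
    have := abs_sub_le ((ratLevel H J (f i j)).val : ℝ) (H * (f i j : ℝ)) (H * B i j)
    linarith
  have hclose : ∀ x y : Level J, levelsClose x y = true ↔ |(x.val : ℝ) - y.val| ≤ 4 := by
    intro x y
    rw [levelsClose, decide_eq_true_eq]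
    exact_mod_cast Iff.rfl
  obtain ⟨col, hcol, hcol'⟩ := exists_netColors_eq_ofFn (c := K) (close := levelsClose)
    (fun a b => ratLevel H J (f a b))
    (fun a w => by simp [hclose])
    (fun a b h w => by rw [hclose, abs_sub_comm, ← hclose]; exact h w)
    (fun s hs => by
      -- Levels that are not close are integers at distance at least 5. The two errors of 2 leave a
      -- distance of 1, so the rows of `B` are separated by `1 / H`.
      have := card_le_of_separated_rows hc (one_div_pos.2 hH0) hB hBc s (by
        intro a ha b hb hab
        have h := hs ha hb hab
        simp only [RowsClose, not_forall, hclose, not_le] at h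
        obtain ⟨w, hw⟩ := h
        refine ⟨w, ?_⟩
        have hw5 : (5 : ℝ) ≤ |((ratLevel H J (f a w)).val : ℝ) - (ratLevel H J (f b w)).val| := by
          have h4 : (4 : ℤ) < |(ratLevel H J (f a w)).val - (ratLevel H J (f b w)).val| := by
            exact_mod_cast hw
          exact_mod_cast (Int.add_one_le_iff.2 h4)
        rw [div_le_iff₀ hH0, mul_comm]
        have e : (H : ℝ) * |B a w - B b w| = |H * B a w - H * B b w| := by
          rw [← mul_sub, abs_mul, abs_of_pos hH0]
        rw [e]
        have h1 := hval a w
        have h2 := hval b w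
        rw [abs_le] at h1 h2
        rw [le_abs] at hw5 ⊢
        rcases hw5 with h | h
        · left; linarith
        · right; linarith)
      exact_mod_cast this.trans hK)
  -- Closeness is not transitive, but both rows are close to one center: `4 + 4` for the levels and
  -- `2 + 2` for the errors make 12.
  refine ⟨col, hcol, fun a b hab w => ?_⟩
  obtain ⟨d, h1, h2⟩ := hcol' a b hab
  have h1 := (hclose _ _).1 (h1 w)
  have h2 := (hclose _ _).1 (h2 w)
  have h3 := hval a w
  have h4 := hval b w
  rw [le_div_iff₀ hH0, mul_comm]
  have e : (H : ℝ) * |B a w - B b w| = |H * B a w - H * B b w| := by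
    rw [← mul_sub, abs_mul, abs_of_pos hH0]
  rw [e]
  rw [abs_le] at *
  constructor <;> linarith

/-- If the completion problem with additive error less than `1/2` is solvable in polynomial time,
then so is a coloring problem with a constant number of colors. -/
theorem exists_coloringInP {k r : ℕ} (hk : 0 < k) {c μ ε : ℝ} (hc : 1 ≤ c) (hμ : 1 ≤ μ)
    (hε : ε < 1 / 2) (h : EntrywiseCompletionProblemInP k r (9 / 10) ε c μ) :
    ∃ K, k ≤ K ∧ ColoringInP k K := by
  obtain ⟨f, hf, hfB⟩ := h
  -- `H` is both the scale of the rounding and the precision asked for, as `2⁻ᴴ ≤ 1 / H`. Rows of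
  -- equal color differ by at most `12 / H`, which has to be below the gap `1 - 2 * ε`; 16 leaves
  -- room.
  obtain ⟨H, hH⟩ := exists_nat_gt (16 / (1 - 2 * ε))
  have hδ : 0 < 1 - 2 * ε := by linarith
  have hH0 : (0 : ℝ) < H := lt_trans (by positivity) hH
  have hHpos : 0 < H := by exact_mod_cast hH0
  rw [div_lt_iff₀ hδ] at hH
  -- The packing bound for separation `1 / H`; the maximum with `k` ensures `k ≤ K`, as the
  -- conjecture requires.
  set K := max k ⌈(2 * c / (1 / H) + 1) ^ r⌉₊ with hKdef
  have hK : (2 * c / (1 / (H : ℝ)) + 1) ^ r ≤ K :=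
    (Nat.le_ceil _).trans (by exact_mod_cast le_max_right _ _)
  have : NeZero K := ⟨by have := le_max_left k ⌈(2 * c / (1 / (H : ℝ)) + 1) ^ r⌉₊; omega⟩
  have : NeZero (21 * k) := ⟨by omega⟩
  refine ⟨K, le_max_left _ _, ?_⟩
  let inst : ColorableGraph k → Instance k (9 / 10) c μ := graphInstance hk hc hμ
  let levels : ∀ G : ColorableGraph k, List (List (Level (H * (⌈c⌉₊ + 1)))) := fun G =>
    List.ofFn fun a => List.ofFn fun b => ratLevel H (H * (⌈c⌉₊ + 1)) (f (inst G) H a b)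
  have hcol : ∀ G : ColorableGraph k, ∃ g : G.1.2.Coloring (Fin K),
      (sample (0 : Fin (21 * k)) (netColors levelsClose (levels G) [])).dropLast =
        List.ofFn fun v => g v := by
    intro G
    obtain ⟨B, ⟨hBr, hBc, hBA⟩, hBf⟩ := hfB (inst G)
    obtain ⟨col, h1, h2⟩ := exists_netColors_of_approx (zero_le_one.trans hc) hHpos hK hBr hBc
      (f := f (inst G) H) (fun i j => (hBf H i j).trans (by
        refine one_div_le_one_div_of_le hH0 ?_
        exact_mod_cast (Nat.lt_two_pow_self (n := H)).le))
    let idx : Fin G.1.1 → Fin ((G.1.1 + 1) * (21 * k)) := fun v =>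
      finProdFinEquiv (v.castSucc, (0 : Fin (21 * k)))
    have hA : ∀ v w, (inst G).1.2 (idx v) (idx w) =
        blockEntry (graphMark G.1.2 v.castSucc w.castSucc) (0 : Fin (21 * k)) 0 := by
      intro v w
      change blockMatrix k (graphMark G.1.2) (idx v) (idx w) = _
      simp only [blockMatrix, Matrix.of_apply, idx, divNat_finProdFinEquiv, modNat_finProdFinEquiv]
    have h0 : ¬ ((0 : Fin (21 * k)).divNat ≠ 0 ∧ (0 : Fin (21 * k)).divNat ≠ 0) := by
      have : (0 : Fin (21 * k)).divNat = 0 := by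
        ext
        simp [Fin.divNat]
      simp [this]
    refine ⟨SimpleGraph.Coloring.mk (fun v => col (idx v)) fun {v w} hvw heq => ?_, ?_⟩
    · have hd := h2 _ _ heq (idx v)
      have hvv := hBA (idx v) (idx v) 1 (by
        rw [hA, (graphMark_eq_diag_iff _ _ _).2 rfl, blockEntry, if_neg h0, if_pos rfl])
      have hwv := hBA (idx w) (idx v) 0 (by
        rw [hA, graphMark_castSucc_of_adj hvw.symm, blockEntry, if_neg h0, if_pos rfl])
      rw [le_div_iff₀ hH0] at hd
      push_cast at hvv hwv
      rw [abs_le] at hvv hwv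
      have h3 : 1 - 2 * ε ≤ |B (idx v) (idx v) - B (idx w) (idx v)| :=
        le_trans (by linarith) (le_abs_self _)
      have h4 := mul_le_mul_of_nonneg_right h3 hH0.le
      linarith
    · have h1' : netColors levelsClose (levels G) [] = List.ofFn col := h1
      rw [h1']
      refine (congrArg List.dropLast (sample_ofFn (G.1.1 + 1) col)).trans ?_
      rw [List.ofFn_succ', List.concat_eq_append, List.dropLast_concat]
      rfl
  choose g hg using hcol
  refine ⟨g, ?_⟩
  have h1 := polyTime_comp (polyTime_graphInstance hk hc hμ H) hf
  have h2 : Nonempty (TM2ComputableInPolyTime (fun G : ColorableGraph k => encodeGraph G.1.2)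
      (fun rows : List (List ℚ) =>
        terminated Γ'.ket (rows.map fun r => terminated Γ'.comma (r.map encodeRat)))
      (fun G => List.ofFn fun a => List.ofFn fun b => f (inst G) H a b)) := by
    refine polyTime_congr id (fun G => rfl) (fun G => ?_) h1
    simp only [id, Function.comp_def, encodeMatrix, matrixRows, List.ofFn_eq_map,
      List.map_map, inst]
  have h3 := polyTime_comp h2 (polyTime_round (zeroCarry H (H * (⌈c⌉₊ + 1))) updateCarry
    levelOfCarry)
  -- The matrix of levels now serves as an encoding of the graph itself. Thus the net machine need
  -- only be correct on matrices that arise from completions.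
  have h4 : Nonempty (TM2ComputableInPolyTime (fun G : ColorableGraph k => encodeGraph G.1.2)
      (fun G => rowsWord (levels G)) id) := by
    refine polyTime_congr id (fun G => rfl) (fun G => ?_) h3
    simp only [id, Function.comp_def, List.ofFn_eq_map, List.map_map, levels]
    rfl
  have h5 := polyTime_comp h4 (polyTime_net (c := K) (L := 21 * k) levelsClose levels (by
    intro G r hr
    simp only [levels, List.mem_ofFn] at hr
    obtain ⟨i, rfl⟩ := hr
    simp [levels]))
  exact polyTime_congr id (fun G => rfl) (fun G => hg G) h5

/-- An exact completion is a completion with arbitrary additive error. -/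
theorem entrywise_of_exact {k r : ℕ} {p c μ ε : ℝ} (hε : 0 ≤ ε)
    (h : CompletionProblemInP k r p 0 c μ) : EntrywiseCompletionProblemInP k r p ε c μ := by
  obtain ⟨f, hf, hfB⟩ := h
  refine ⟨f, hf, fun A => ?_⟩
  obtain ⟨B, ⟨hBr, hBc, hBA⟩, hBf⟩ := hfB A
  refine ⟨B, ⟨hBr, hBc, fun i j a ha => ?_⟩, hBf⟩
  have hnn : ∀ i j, 0 ≤ (A.1.2 i j).elim 0 fun a => |(a : ℝ) - B i j| ^ 2 := by
    intro i j
    cases A.1.2 i j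
    · exact le_rfl
    · exact sq_nonneg _
  have h0 : (A.1.2 i j).elim 0 (fun a => |(a : ℝ) - B i j| ^ 2) ≤ 0 := by
    refine le_trans ?_ (hBA.trans (by simp))
    refine le_trans ?_ (Finset.single_le_sum
      (f := fun i => ∑ j, (A.1.2 i j).elim 0 fun a => |(a : ℝ) - B i j| ^ 2)
      (fun i _ => Finset.sum_nonneg fun j _ => hnn i j) (Finset.mem_univ i))
    exact Finset.single_le_sum (f := fun j => (A.1.2 i j).elim 0 fun a => |(a : ℝ) - B i j| ^ 2)
      (fun j _ => hnn i j) (Finset.mem_univ j)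
  rw [ha, Option.elim_some] at h0
  rw [pow_eq_zero_iff two_ne_zero |>.1 (le_antisymm h0 (sq_nonneg |(a : ℝ) - B i j|))]
  exact hε

end MatrixCompletion

theorem theorem1p8 (hcol : MatrixCompletion.ColoringConjecture)
    (c : ℝ) (hc : 1 ≤ c) (k r : ℕ) (hk : 3 ≤ k) (hr : k < r) (μ : ℝ) (hμ : 1 ≤ μ) :
    ¬ MatrixCompletion.CompletionProblemInP k r (9 / 10) 0 c μ ∧
    ∀ ε : ℝ, 0 < ε → ε < 1 / 2 →
      ¬ MatrixCompletion.EntrywiseCompletionProblemInP k r (9 / 10) ε c μ := by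
  have key : ∀ ε : ℝ, ε < 1 / 2 →
      ¬ MatrixCompletion.EntrywiseCompletionProblemInP k r (9 / 10) ε c μ := by
    intro ε hε h
    obtain ⟨K, hK, hcolK⟩ := MatrixCompletion.exists_coloringInP (by omega) hc hμ hε h
    exact hcol k K hk hK hcolK
  exact ⟨fun h => key 0 (by norm_num) (MatrixCompletion.entrywise_of_exact le_rfl h),
    fun ε _ hε => key ε hε⟩
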